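/- A finite simple graph $G$ is \emph{perfect} if $\chi(H)=\omega(H)$ for every induced subgraph $H$ of $G$, where $\chi(H)$ is the chromatic number of $H$ and $\omega(H)$ is the number of vertices of a largest clique of $H$. A \emph{pure pair} in $G$ is a pair $A,B$ of disjoint subsets of $V(G)$ such that either every vertex in $A$ is adjacent to every vertex in $B$, or no vertex in $A$ is adjacent to a vertex in $B$. Write $|G|$ for the number of vertices of $G$. For every real number $c>0$ there exists $\varepsilon>0$ such that every finite simple perfect graph $G$ with $|G|>1$ has a pure pair $A,B$ with $|A|\ge \varepsilon|G|$ and $|B|\ge \varepsilon|G|^{1-c}$. -/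

import Mathlib

universe u

namespace SimpleGraph

/-- A graph is perfect if the chromatic number of each of its induced subgraphs equals the
size of the largest clique of that subgraph. -/
def IsPerfect {V : Type u} (G : SimpleGraph V) : Prop :=
  ∀ s : Set V, (G.induce s).chromaticNumber = ((G.induce s).cliqueNum : ℕ∞)

/-- `A` is anticomplete to `B`: no vertex in `A` is adjacent to a vertex in `B`. -/
def IsAnticompleteBetween {V : Type u} (G : SimpleGraph V) (A B : Set V) : Prop :=
  ∀ ⦃a⦄, a ∈ A → ∀ ⦃b⦄, b ∈ B → ¬ G.Adj a b

/-- A pure pair: disjoint sets of vertices, complete or anticomplete to each other. -/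
def IsPurePair {V : Type u} (G : SimpleGraph V) (A B : Finset V) : Prop :=
  Disjoint A B ∧ (G.IsCompleteBetween (A : Set V) (B : Set V) ∨
    G.IsAnticompleteBetween (A : Set V) (B : Set V))

end SimpleGraph

/-! Perfection enters only through `CliqueIndepBound`: colouring an induced subgraph with ω colours
gives |s| ≤ ωα. This inequality is hereditary and invariant under complement, and an odd hole of
length at least five violates it. So neither the graph nor its complement has such a hole, and no
perfect graph theorem is needed.

Excluding the pentagon yields a Rödl-type statement (second `exists_small_degree`): some set of
linear size induces, in G or in its complement, a graph whose maximum degree is at most a small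
fraction of its order. It then suffices to find an anticomplete pair in a sparse graph. If there is
none, the graph is `Spread d m` with d linear in n and m of order n^(1-c), so that every set of size
m has neighbours almost everywhere.

The contradiction is one of parity. Two anticomplete connected sets with a common attached vertex
provide induced paths which, closed up by an edge or by a path of length two, form holes; these must
be even (`exists_parity`). Hence there are no three connected sets, pairwise anticomplete, each with
a large set of neighbours that have no neighbour in the other two (`Spread.false_of_triple`). Such
sets are nevertheless built from balls (`Spread.false_of_large`). Balls grow quickly
(`Spread.exists_large_ball`), so only boundedly many radii and covering costs matter; stopping at
the last value where a bound survives gives a set on which they are stable (`Spread.exists_stable`).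
There, parity separates each new connected set from the neighbours of the earlier ones
(`Spread.exists_private`). -/

namespace SimpleGraph

section PurePairs

variable {V : Type u} {G : SimpleGraph V}

/-! ### Clique and independent set products; absence of odd holes -/

/-- Every finite set of vertices `s` contains a clique and an independent set whose sizes have
product at least `|s|`. -/
def CliqueIndepBound (G : SimpleGraph V) : Prop :=
  ∀ s : Finset V, ∃ K I : Finset V, K ⊆ s ∧ I ⊆ s ∧ G.IsClique (K : Set V) ∧
    G.IsIndepSet (I : Set V) ∧ s.card ≤ K.card * I.card

/-- The two factors exchange roles. This symmetry lets the sparse and the dense case be treated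
alike. -/
theorem CliqueIndepBound.compl (h : G.CliqueIndepBound) : Gᶜ.CliqueIndepBound := by
  intro s
  obtain ⟨K, I, hK, hI, hKc, hIi, hc⟩ := h s
  exact ⟨I, K, hI, hK, by simpa using hIi, by simpa using hKc, by rwa [mul_comm]⟩

theorem CliqueIndepBound.comap {W : Type u} (f : W ↪ V) (h : G.CliqueIndepBound) :
    (G.comap f).CliqueIndepBound := by
  classical
  intro s
  obtain ⟨K, I, hK, hI, hKc, hIi, hc⟩ := h (s.map f)
  have key : ∀ t ⊆ s.map f, ∃ t' ⊆ s, t'.map f = t := by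
    intro t ht
    refine ⟨s.filter (fun v => f v ∈ t), Finset.filter_subset _ _, ?_⟩
    ext x
    simp only [Finset.mem_map, Finset.mem_filter]
    constructor
    · rintro ⟨a, ⟨-, ha⟩, rfl⟩; exact ha
    · intro hx
      obtain ⟨a, ha, rfl⟩ := Finset.mem_map.1 (ht hx)
      exact ⟨a, ⟨ha, hx⟩, rfl⟩
  obtain ⟨K', hK', rfl⟩ := key K hK
  obtain ⟨I', hI', rfl⟩ := key I hI
  refine ⟨K', I', hK', hI', ?_, ?_, by simpa using hc⟩
  · intro a ha b hb hab
    exact hKc (by simpa using ha) (by simpa using hb) (f.injective.ne hab)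
  · intro a ha b hb hab
    exact hIi (by simpa using ha) (by simpa using hb) (f.injective.ne hab)

/-- An induced subgraph is coloured with as many colours as its largest clique has vertices, and
each colour class is independent. -/
theorem IsPerfect.cliqueIndepBound (h : G.IsPerfect) : G.CliqueIndepBound := by
  classical
  intro s
  set H := G.induce (s : Set V) with hH
  have h1 := h (s : Set V)
  have hcol : H.Colorable H.cliqueNum := chromaticNumber_le_iff_colorable.1 h1.le
  obtain ⟨C⟩ := hcol
  obtain ⟨K, hK⟩ := H.exists_isNClique_cliqueNum
  obtain ⟨I, hI⟩ := H.exists_isNIndepSet_indepNum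
  have hcard : s.card ≤ H.cliqueNum * H.indepNum := by
    have e : Fintype.card (s : Set V) = s.card := by simp
    have := Finset.card_le_mul_card_image (s := (Finset.univ : Finset (s : Set V)))
      (f := C) H.indepNum (by
        intro b _
        apply IsIndepSet.card_le_indepNum
        intro x hx y hy _ hadj
        simp only [Finset.coe_filter, Set.mem_ofPred_eq, Finset.mem_univ, true_and] at hx hy
        exact C.valid hadj (hx.trans hy.symm))
    have h3 : (Finset.univ.image C).card ≤ H.cliqueNum := by
      simpa using Finset.card_le_univ (Finset.univ.image C)
    rw [Finset.card_univ, e] at this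
    calc s.card ≤ _ := this
      _ ≤ H.indepNum * H.cliqueNum := Nat.mul_le_mul_left _ h3
      _ = _ := mul_comm _ _
  refine ⟨K.map (Function.Embedding.subtype _), I.map (Function.Embedding.subtype _), ?_, ?_, ?_,
    ?_, ?_⟩
  · intro x hx
    obtain ⟨y, -, rfl⟩ := Finset.mem_map.1 hx
    exact y.2
  · intro x hx
    obtain ⟨y, -, rfl⟩ := Finset.mem_map.1 hx
    exact y.2
  · intro a ha b hb hab
    simp only [Finset.coe_map, Function.Embedding.subtype_apply, Set.mem_image] at ha hb
    obtain ⟨a, ha, rfl⟩ := ha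
    obtain ⟨b, hb, rfl⟩ := hb
    exact hK.1 ha hb (fun e => hab (by rw [e]))
  · intro a ha b hb hab
    simp only [Finset.coe_map, Function.Embedding.subtype_apply, Set.mem_image] at ha hb
    obtain ⟨a, ha, rfl⟩ := ha
    obtain ⟨b, hb, rfl⟩ := hb
    exact hI.1 ha hb (fun e => hab (by rw [e]))
  · simpa [hK.2, hI.2] using hcard

/-- `h 0, …, h (N - 1)` are the vertices of an induced cycle, in order. -/
def IsHole (G : SimpleGraph V) (N : ℕ) (h : ℕ → V) : Prop :=
  ∀ i j, i < j → j < N → h i ≠ h j ∧ (G.Adj (h i) (h j) ↔ (j = i + 1 ∨ (i = 0 ∧ j + 1 = N)))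

/-- A cycle of length 2k+1 ≥ 5 has no triangle and no independent set of more than k vertices, and
2k < 2k+1. -/
theorem CliqueIndepBound.not_isHole (hG : G.CliqueIndepBound) {k : ℕ} (hk : 2 ≤ k) {h : ℕ → V} :
    ¬ G.IsHole (2 * k + 1) h := by
  classical
  intro hh
  have hinj : Set.InjOn h (Finset.range (2 * k + 1)) := by
    intro i hi j hj hij
    simp only [Finset.coe_range, Set.mem_Iio] at hi hj
    rcases lt_trichotomy i j with hl | hl | hl
    · exact absurd hij (hh i j hl hj).1
    · exact hl
    · exact absurd hij.symm (hh j i hl hi).1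
  obtain ⟨K, I, hK, hI, hKc, hIi, hc⟩ := hG ((Finset.range (2 * k + 1)).image h)
  rw [Finset.card_image_of_injOn hinj, Finset.card_range] at hc
  have key : ∀ t ⊆ (Finset.range (2 * k + 1)).image h, ∃ J ⊆ Finset.range (2 * k + 1),
      J.card = t.card ∧ ∀ j ∈ J, h j ∈ t := by
    intro t ht
    refine ⟨(Finset.range (2 * k + 1)).filter (fun i => h i ∈ t), Finset.filter_subset _ _, ?_, ?_⟩
    · have : t = ((Finset.range (2 * k + 1)).filter (fun i => h i ∈ t)).image h := by
        ext x
        simp only [Finset.mem_image, Finset.mem_filter]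
        constructor
        · intro hx
          obtain ⟨a, ha, rfl⟩ := Finset.mem_image.1 (ht hx)
          exact ⟨a, ⟨ha, hx⟩, rfl⟩
        · rintro ⟨a, ⟨-, ha⟩, rfl⟩; exact ha
      conv_rhs => rw [this]
      rw [Finset.card_image_of_injOn (hinj.mono
        (Finset.coe_subset.2 (Finset.filter_subset (fun i => h i ∈ t) _)))]
    · intro j hj; exact (Finset.mem_filter.1 hj).2
  have hK2 : K.card ≤ 2 := by
    obtain ⟨J, hJ, hJc, hJt⟩ := key K hK
    rw [← hJc]
    by_contra! h3
    obtain ⟨a, b, c, ha, hb, hc, hab, hac, hbc⟩ := Finset.two_lt_card_iff.1 h3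
    have hadj : ∀ i ∈ J, ∀ j ∈ J, i < j → (j = i + 1 ∨ (i = 0 ∧ j = 2 * k)) := by
      intro i hi j hj hij
      have hj' := Finset.mem_range.1 (hJ hj)
      have := (hh i j hij hj').2.1 (hKc (hJt i hi) (hJt j hj) (hh i j hij hj').1)
      omega
    have h1 := hadj a ha b hb
    have h2 := hadj b hb a ha
    have h3 := hadj a ha c hc
    have h4 := hadj c hc a ha
    have h5 := hadj b hb c hc
    have h6 := hadj c hc b hb
    omega
  have hI2 : I.card ≤ k := by
    obtain ⟨J, hJ, hJc, hJt⟩ := key I hI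
    rw [← hJc]
    have hna : ∀ i ∈ J, ∀ j ∈ J, i < j → ¬ (j = i + 1 ∨ (i = 0 ∧ j = 2 * k)) := by
      intro i hi j hj hij hor
      have hj' := Finset.mem_range.1 (hJ hj)
      exact hIi (hJt i hi) (hJt j hj) (hh i j hij hj').1 ((hh i j hij hj').2.2 (by omega))
    -- Successor on the cycle: an independent index set is disjoint from its shift, so twice its
    -- size is at most 2k+1.
    let σ : ℕ → ℕ := fun i => if i = 2 * k then 0 else i + 1
    have hσ : Set.InjOn σ J := by
      intro i hi j hj hij
      have := Finset.mem_range.1 (hJ hi)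
      have := Finset.mem_range.1 (hJ hj)
      simp only [σ] at hij
      split_ifs at hij <;> omega
    have hdis : Disjoint J (J.image σ) := by
      rw [Finset.disjoint_left]
      intro i hi hi2
      obtain ⟨j, hj, hji⟩ := Finset.mem_image.1 hi2
      have hj1 := Finset.mem_range.1 (hJ hj)
      simp only [σ] at hji
      split_ifs at hji with h0
      · exact hna i hi j hj (by omega) (Or.inr ⟨hji.symm, h0⟩)
      · exact hna j hj i hi (by omega) (Or.inl hji.symm)
    have hsub : J ∪ J.image σ ⊆ Finset.range (2 * k + 1) := by
      apply Finset.union_subset hJ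
      intro i hi
      obtain ⟨j, hj, hji⟩ := Finset.mem_image.1 hi
      have hj1 := Finset.mem_range.1 (hJ hj)
      simp only [σ] at hji
      rw [Finset.mem_range]
      split_ifs at hji <;> omega
    have := Finset.card_le_card hsub
    rw [Finset.card_union_of_disjoint hdis, Finset.card_image_of_injOn hσ,
      Finset.card_range] at this
    omega
  have := Nat.mul_le_mul hK2 hI2
  omega

/-! ### Induced paths and linked sets -/

/-- `p 0, …, p l` is an induced path. -/
def IsInducedPath (G : SimpleGraph V) (l : ℕ) (p : ℕ → V) : Prop :=
  ∀ i j, i < j → j ≤ l → p i ≠ p j ∧ (G.Adj (p i) (p j) ↔ j = i + 1)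

/-- Two induced paths from a common vertex whose other ends are adjacent form a hole. -/
theorem isHole_of_paths {k l : ℕ} {p r : ℕ → V} (hp : G.IsInducedPath k p)
    (hr : G.IsInducedPath l r) (h0 : p 0 = r 0) (hadj : G.Adj (p k) (r l))
    (hk : 2 ≤ k) (hl : 1 ≤ l)
    (hcross : ∀ i j, 1 ≤ i → i ≤ k → 1 ≤ j → j ≤ l → p i ≠ r j ∧
      (G.Adj (p i) (r j) → i = k ∧ j = l)) :
    G.IsHole (k + l + 1) (fun i => if i ≤ k then p i else r (k + l + 1 - i)) := by
  -- The cycle runs along `p` and returns along `r`: position k+1 is `r l`, and the last position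
  -- k+l is `r 1`.
  intro i j hij hj
  by_cases hik : i ≤ k
  · by_cases hjk : j ≤ k
    · simp only [hik, hjk, if_true]
      refine ⟨(hp i j hij hjk).1, ?_⟩
      rw [(hp i j hij hjk).2]
      omega
    · simp only [hik, hjk, if_true, if_false]
      rcases Nat.eq_zero_or_pos i with rfl | hi
      · rw [h0]
        have := hr 0 (k + l + 1 - j) (by omega) (by omega)
        refine ⟨this.1, ?_⟩
        rw [this.2]
        omega
      · have := hcross i (k + l + 1 - j) hi hik (by omega) (by omega)
        refine ⟨this.1, ?_⟩
        constructor
        · intro h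
          have := this.2 h
          omega
        · intro h
          have h1 : i = k := by omega
          have h2 : k + l + 1 - j = l := by omega
          rw [h1, h2]; exact hadj
  · have hjk : ¬ j ≤ k := by omega
    simp only [hik, hjk, if_false]
    have := hr (k + l + 1 - j) (k + l + 1 - i) (by omega) (by omega)
    refine ⟨this.1.symm, ?_⟩
    rw [G.adj_comm, this.2]
    omega

/-- `u` and `v` are joined by a walk inside `T`. -/
def Linked (G : SimpleGraph V) (T : Finset V) : V → V → Prop :=
  Relation.ReflTransGen (fun x y => x ∈ T ∧ y ∈ T ∧ G.Adj x y)

/-- The set `T` induces a connected subgraph (or is empty). -/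
def IsLinked (G : SimpleGraph V) (T : Finset V) : Prop :=
  ∀ u ∈ T, ∀ v ∈ T, G.Linked T u v

theorem Linked.symm {T : Finset V} {u v : V} (h : G.Linked T u v) : G.Linked T v u := by
  induction h with
  | refl => exact Relation.ReflTransGen.refl
  | tail _ hbc ih => exact Relation.ReflTransGen.head ⟨hbc.2.1, hbc.1, hbc.2.2.symm⟩ ih

theorem Linked.mono {S T : Finset V} (hST : S ⊆ T) {u v : V} (h : G.Linked S u v) :
    G.Linked T u v := by
  induction h with
  | refl => exact Relation.ReflTransGen.refl
  | tail _ hbc ih => exact ih.tail ⟨hST hbc.1, hST hbc.2.1, hbc.2.2⟩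

theorem isLinked_of_root {T : Finset V} {r : V} (h : ∀ u ∈ T, G.Linked T r u) : G.IsLinked T :=
  fun u hu v hv => Relation.ReflTransGen.trans (h u hu).symm (h v hv)

theorem isLinked_singleton (v : V) : G.IsLinked {v} := by
  intro a ha b hb
  rw [Finset.mem_singleton] at ha hb
  subst ha; subst hb
  exact Relation.ReflTransGen.refl

theorem IsLinked.union {K B : Finset V} [DecidableEq V] (hK : G.IsLinked K) (hne : K.Nonempty)
    (hB : ∀ b ∈ B, b ∈ K ∨ ∃ k ∈ K, G.Adj k b) : G.IsLinked (K ∪ B) := by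
  obtain ⟨r, hr⟩ := hne
  apply isLinked_of_root (r := r)
  have h1 : ∀ u ∈ K, G.Linked (K ∪ B) r u :=
    fun u hu => (hK r hr u hu).mono Finset.subset_union_left
  intro u hu
  by_cases huK : u ∈ K
  · exact h1 u huK
  · have huB := (Finset.mem_union.1 hu).resolve_left huK
    obtain ⟨k, hk, hadj⟩ := (hB u huB).resolve_left huK
    exact (h1 k hk).tail ⟨Finset.mem_union_left _ hk, hu, hadj⟩

/-- Through a linked set there is an induced path between two attached vertices. -/
theorem IsLinked.exists_isInducedPath {T : Finset V} (hT : G.IsLinked T) {a x : V} (hax : a ≠ x)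
    (ha : ∃ t ∈ T, G.Adj a t) (hx : ∃ t ∈ T, G.Adj x t) :
    ∃ l p, G.IsInducedPath l p ∧ p 0 = a ∧ p l = x ∧ 1 ≤ l ∧ (∀ i, 0 < i → i < l → p i ∈ T) := by
  classical
  -- Walks from `a` to `x` with interior in `T`; one of minimal length is induced.
  let P : ℕ → Prop := fun l => ∃ p : ℕ → V, p 0 = a ∧ p l = x ∧
    (∀ i, 0 < i → i < l → p i ∈ T) ∧ (∀ i < l, G.Adj (p i) (p (i + 1)))
  have hex : ∃ l, P l := by
    obtain ⟨t, ht, hat⟩ := ha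
    obtain ⟨t', ht', hxt'⟩ := hx
    have h1 : ∀ u, G.Linked T t u → ∃ (l : ℕ) (p : ℕ → V), 1 ≤ l ∧ p 0 = a ∧ p l = u ∧
        (∀ i, 0 < i → i ≤ l → p i ∈ T) ∧ (∀ i < l, G.Adj (p i) (p (i + 1))) := by
      intro u hu
      induction hu with
      | refl =>
        refine ⟨1, fun i => if i = 0 then a else t, le_rfl, by simp, by simp, ?_, ?_⟩
        · intro i h0 _
          simp [h0.ne', ht]
        · intro i hi
          have : i = 0 := by omega
          subst this
          simpa using hat
      | @tail b c _ hbc ih =>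
        obtain ⟨l, p, hl, h0, h1, h2, h3⟩ := ih
        refine ⟨l + 1, fun i => if i ≤ l then p i else c, by omega, by simp [h0], by simp, ?_, ?_⟩
        · intro i hi hil
          by_cases h : i ≤ l
          · simpa [h] using h2 i hi h
          · simpa [h] using hbc.2.1
        · intro i hi
          by_cases h : i < l
          · have h' : i + 1 ≤ l := h
            simpa [h.le, h'] using h3 i h
          · have : i = l := by omega
            subst this
            simpa [h1] using hbc.2.2
    obtain ⟨l, p, hl, h0, h1, h2, h3⟩ := h1 t' (hT t ht t' ht')
    refine ⟨l + 1, fun i => if i ≤ l then p i else x, by simp [h0], by simp, ?_, ?_⟩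
    · intro i hi hil
      have : i ≤ l := by omega
      simpa [this] using h2 i hi this
    · intro i hi
      by_cases h : i < l
      · have h' : i + 1 ≤ l := h
        simpa [h.le, h'] using h3 i h
      · have : i = l := by omega
        subst this
        simpa [h1] using hxt'.symm
  obtain ⟨p, h0, h1, h2, h3⟩ := Nat.find_spec hex
  have hmin : ∀ l, P l → Nat.find hex ≤ l := fun l hl => Nat.find_min' hex hl
  set l := Nat.find hex with hl
  have hl1 : 1 ≤ l := by
    by_contra! h
    have : l = 0 := by omega
    rw [this, h0] at h1
    exact hax h1
  refine ⟨l, p, ?_, h0, h1, hl1, h2⟩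
  have hadj : ∀ i j, i < j → j ≤ l → G.Adj (p i) (p j) → j = i + 1 := by
    intro i j hij hj hadj
    by_contra hne
    -- A chord from `p i` to `p j` lets the walk skip the j-i-1 vertices between them.
    have := hmin (l - (j - i - 1)) ⟨fun s => if s ≤ i then p s else p (s + (j - i - 1)),
      by simp [h0], ?_, ?_, ?_⟩
    · omega
    · have e1 : ¬ (l - (j - i - 1) ≤ i) := by omega
      have e2 : l - (j - i - 1) + (j - i - 1) = l := by omega
      simp only [e1, if_false, e2, h1]
    · intro s hs hsl
      by_cases h : s ≤ i
      · simpa [h] using h2 s hs (by omega)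
      · simpa [h] using h2 _ (by omega) (by omega)
    · intro s hs
      by_cases h : s ≤ i
      · by_cases h' : s + 1 ≤ i
        · simpa [h, h'] using h3 s (by omega)
        · have e1 : s = i := by omega
          have e2 : s + 1 + (j - i - 1) = j := by omega
          simp only [h, if_true, h', if_false, e2]
          rw [e1]; exact hadj
      · have h' : ¬ s + 1 ≤ i := by omega
        have e2 : s + 1 + (j - i - 1) = s + (j - i - 1) + 1 := by omega
        simp only [h, h', if_false, e2]
        exact h3 _ (by omega)
  intro i j hij hj
  refine ⟨?_, hadj i j hij hj, ?_⟩
  -- A repeated vertex also gives a chord, from `p i` to `p (j+1)` or from `p (i-1)` to `p j`,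
  -- unless the two ends coincide.
  · intro heq
    rcases eq_or_lt_of_le hj with hjl | hjl
    · rcases Nat.eq_zero_or_pos i with hi | hi
      · rw [hi, h0, hjl, h1] at heq
        exact hax heq
      · have := hadj (i - 1) j (by omega) hj (by
          rw [← heq]
          have := h3 (i - 1) (by omega)
          rwa [show i - 1 + 1 = i by omega] at this)
        omega
    · have := hadj i (j + 1) (by omega) (by omega) (by rw [heq]; exact h3 j hjl)
      omega
  · rintro rfl
    exact h3 i (by omega)

/-! ### Parity of paths through two anticomplete linked sets -/

/-- `x` is outside `T` and has a neighbour in `T`. -/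
def Attached (G : SimpleGraph V) (T : Finset V) (x : V) : Prop :=
  x ∉ T ∧ ∃ t ∈ T, G.Adj t x

/-- `x` is outside `T` and has no neighbour in `T`. -/
def Detached (G : SimpleGraph V) (T : Finset V) (x : V) : Prop :=
  x ∉ T ∧ ∀ t ∈ T, ¬ G.Adj t x

theorem Detached.mono {S T : Finset V} (h : S ⊆ T) {x : V} (hx : G.Detached T x) :
    G.Detached S x :=
  ⟨fun hS => hx.1 (h hS), fun t ht => hx.2 t (h ht)⟩

theorem Detached.ne {T : Finset V} {x t : V} (hx : G.Detached T x) (ht : t ∈ T) : t ≠ x :=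
  fun h => hx.1 (h ▸ ht)

theorem Detached.union [DecidableEq V] {S T : Finset V} {x : V} (hS : G.Detached S x)
    (hT : G.Detached T x) : G.Detached (S ∪ T) x := by
  refine ⟨fun h => (Finset.mem_union.1 h).elim hS.1 hT.1, fun t ht => ?_⟩
  exact (Finset.mem_union.1 ht).elim (hS.2 t) (hT.2 t)

/-- In a graph without odd holes, two anticomplete linked sets `T` and `K` that share an attached
vertex `a` determine parities for the vertices attached to them. -/
theorem CliqueIndepBound.exists_parity [DecidableEq V] (hQ : G.CliqueIndepBound) {T K : Finset V}
    (hT : G.IsLinked T) (hK : G.IsLinked K) {a : V} (haT : G.Attached T a) (haK : G.Attached K a)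
    (hTK : ∀ t ∈ T, G.Detached K t) :
    ∃ f g : V → ℕ, ∀ x b, G.Attached T x → G.Detached (insert a K) x → G.Attached K b →
      G.Detached T b → b ≠ a →
      (G.Adj x b → Odd (f x + g b)) ∧
      (∀ y, G.Detached T y → G.Detached (insert a K) y → G.Adj x y → G.Adj y b →
        ¬ G.Adj x b → Even (f x + g b)) := by
  -- One path per vertex is fixed, so that its length depends on that vertex alone. The value 0 for
  -- other vertices is a dummy.
  have hf : ∀ x, ∃ l, G.Attached T x → x ≠ a → ∃ p, G.IsInducedPath l p ∧ p 0 = a ∧ p l = x ∧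
      1 ≤ l ∧ (∀ i, 0 < i → i < l → p i ∈ T) := by
    intro x
    by_cases h : G.Attached T x ∧ x ≠ a
    · obtain ⟨l, p, hp⟩ := hT.exists_isInducedPath h.2.symm
        (haT.2.imp fun t ht => ⟨ht.1, ht.2.symm⟩) (h.1.2.imp fun t ht => ⟨ht.1, ht.2.symm⟩)
      exact ⟨l, fun _ _ => ⟨p, hp⟩⟩
    · exact ⟨0, fun h1 h2 => absurd ⟨h1, h2⟩ h⟩
  have hg : ∀ x, ∃ l, G.Attached K x → x ≠ a → ∃ p, G.IsInducedPath l p ∧ p 0 = a ∧ p l = x ∧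
      1 ≤ l ∧ (∀ i, 0 < i → i < l → p i ∈ K) := by
    intro x
    by_cases h : G.Attached K x ∧ x ≠ a
    · obtain ⟨l, p, hp⟩ := hK.exists_isInducedPath h.2.symm
        (haK.2.imp fun t ht => ⟨ht.1, ht.2.symm⟩) (h.1.2.imp fun t ht => ⟨ht.1, ht.2.symm⟩)
      exact ⟨l, fun _ _ => ⟨p, hp⟩⟩
    · exact ⟨0, fun h1 h2 => absurd ⟨h1, h2⟩ h⟩
  choose f hf using hf
  choose g hg using hg
  refine ⟨f, g, ?_⟩
  intro x b hxT hxK hbK hbT hba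
  have haI : a ∈ insert a K := Finset.mem_insert_self _ _
  have hKI : K ⊆ insert a K := Finset.subset_insert _ _
  have hxK' := hxK.mono hKI
  obtain ⟨p, hp, hp0, hpk, hk1, hpT⟩ := hf x hxT (hxK.ne haI).symm
  obtain ⟨r, hr, hr0, hrl, hl1, hrK⟩ := hg b hbK hba
  -- A path of length one would make `x` adjacent to `a`.
  have hk2 : 2 ≤ f x := by
    by_contra! h
    have h1 : f x = 1 := by omega
    have := (hp 0 (f x) (by omega) le_rfl).2.2 (by omega)
    rw [hp0, hpk] at this
    exact hxK.2 a haI this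
  constructor
  -- The edge `xb` closes the two paths to a hole of length f x + g b + 1, which must be even.
  · intro hxb
    by_contra hodd
    rw [Nat.not_odd_iff_even] at hodd
    have hole := isHole_of_paths hp hr (hp0.trans hr0.symm) (by rwa [hpk, hrl]) hk2 hl1 (by
      intro i j hi hik hj hjl
      rcases hik.lt_or_eq with hik | hik <;> rcases hjl.lt_or_eq with hjl | hjl
      · have h1 := hTK _ (hpT i hi hik)
        have h2 := hrK j hj hjl
        exact ⟨(h1.ne h2).symm, fun h => absurd h.symm (h1.2 _ h2)⟩
      · have h1 := hpT i hi hik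
        rw [hjl, hrl]
        exact ⟨hbT.ne h1, fun h => absurd h (hbT.2 _ h1)⟩
      · have h2 := hrK j hj hjl
        rw [hik, hpk]
        exact ⟨(hxK'.ne h2).symm, fun h => absurd h.symm (hxK'.2 _ h2)⟩
      · rw [hik, hjl, hpk, hrl]
        exact ⟨hxb.ne, fun _ => ⟨rfl, rfl⟩⟩)
    obtain ⟨c, hc⟩ := hodd
    rw [show f x + g b + 1 = 2 * c + 1 by omega] at hole
    exact hQ.not_isHole (by omega) hole
  -- Appending `y` to the path through `K` lengthens the hole by one, which reverses the parity.
  · intro y hyT hyK hxy hyb hxb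
    have hyK' := hyK.mono hKI
    by_contra hev
    rw [Nat.not_even_iff_odd] at hev
    have hri : ∀ i, i < g b → G.Detached {r i} y := by
      intro i hi
      rcases Nat.eq_zero_or_pos i with rfl | h
      · rw [hr0]; exact hyK.mono (by simp)
      · exact hyK'.mono (by simpa using hrK i h hi)
    have hby : y ≠ b := hyb.ne
    have hr' : G.IsInducedPath (g b + 1) (fun i => if i ≤ g b then r i else y) := by
      intro i j hij hj
      have hi : i ≤ g b := by omega
      by_cases hjg : j ≤ g b
      · simpa only [hi, hjg, if_true] using hr i j hij hjg
      · have hj' : j = g b + 1 := by omega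
        simp only [hi, hjg, if_true, if_false]
        rcases hi.lt_or_eq with hi' | hi'
        · have h1 := hri i hi'
          refine ⟨h1.ne (by simp), fun h => absurd h (h1.2 _ (by simp)), fun h => by omega⟩
        · rw [hi', hrl]
          exact ⟨hby.symm, fun _ => hj', fun _ => hyb.symm⟩
    have hole := isHole_of_paths hp hr' (by simpa using hp0.trans hr0.symm)
      (by simpa [hpk] using hxy) hk2 (by omega) (by
      intro i j hi hik hj hjl
      by_cases hjg : j ≤ g b
      · simp only [hjg, if_true]
        rcases hik.lt_or_eq with hik | hik <;> rcases hjg.lt_or_eq with hjl' | hjl'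
        · have h1 := hTK _ (hpT i hi hik)
          have h2 := hrK j hj hjl'
          exact ⟨(h1.ne h2).symm, fun h => absurd h.symm (h1.2 _ h2)⟩
        · have h1 := hpT i hi hik
          rw [hjl', hrl]
          exact ⟨hbT.ne h1, fun h => absurd h (hbT.2 _ h1)⟩
        · have h2 := hrK j hj hjl'
          rw [hik, hpk]
          exact ⟨(hxK'.ne h2).symm, fun h => absurd h.symm (hxK'.2 _ h2)⟩
        · rw [hik, hjl', hpk, hrl]
          refine ⟨?_, fun h => absurd h hxb⟩
          rintro rfl
          obtain ⟨t, ht, hadj⟩ := hxT.2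
          exact hbT.2 t ht hadj
      · have hj' : j = g b + 1 := by omega
        simp only [hjg, if_false]
        rcases hik.lt_or_eq with hik | hik
        · have h1 := hpT i hi hik
          exact ⟨hyT.ne h1, fun h => absurd h (hyT.2 _ h1)⟩
        · rw [hik, hpk]
          exact ⟨hxy.ne, fun _ => ⟨rfl, hj'⟩⟩)
    obtain ⟨c, hc⟩ := hev
    rw [show f x + (g b + 1) + 1 = 2 * (c + 1) + 1 by omega] at hole
    exact hQ.not_isHole (by omega) hole

/-! ### Neighbourhoods and covering in spread graphs -/

/-- The members of `S` with a neighbour in `B`. -/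
noncomputable def nbrs (G : SimpleGraph V) (B S : Finset V) : Finset V :=
  open Classical in S.filter (fun v => ∃ b ∈ B, G.Adj b v)

@[simp] theorem mem_nbrs {B S : Finset V} {v : V} :
    v ∈ G.nbrs B S ↔ v ∈ S ∧ ∃ b ∈ B, G.Adj b v := by
  simp [nbrs]

theorem nbrs_subset {B S : Finset V} : G.nbrs B S ⊆ S := fun _ h => (mem_nbrs.1 h).1

theorem nbrs_mono {B B' S S' : Finset V} (hB : B ⊆ B') (hS : S ⊆ S') :
    G.nbrs B S ⊆ G.nbrs B' S' := by
  intro v hv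
  obtain ⟨h, b, hb, hadj⟩ := mem_nbrs.1 hv
  exact mem_nbrs.2 ⟨hS h, b, hB hb, hadj⟩

theorem nbrs_union [DecidableEq V] {B B' S : Finset V} :
    G.nbrs (B ∪ B') S = G.nbrs B S ∪ G.nbrs B' S := by
  ext v
  simp only [mem_nbrs, Finset.mem_union]
  constructor
  · rintro ⟨h, b, hb | hb, hadj⟩
    · exact Or.inl ⟨h, b, hb, hadj⟩
    · exact Or.inr ⟨h, b, hb, hadj⟩
  · rintro (⟨h, b, hb, hadj⟩ | ⟨h, b, hb, hadj⟩)
    · exact ⟨h, b, Or.inl hb, hadj⟩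
    · exact ⟨h, b, Or.inr hb, hadj⟩

/-- Every vertex has at most `d` neighbours, and there is no anticomplete pair of disjoint sets
of sizes at least `d` and at least `m`. -/
structure Spread (G : SimpleGraph V) (d m : ℕ) : Prop where
  degree : ∀ v S, (G.nbrs {v} S).card ≤ d
  dominate : ∀ A B : Finset V, Disjoint A B → d ≤ A.card → m ≤ B.card →
    ∃ a ∈ A, ∃ b ∈ B, G.Adj a b
  m_pos : 1 ≤ m
  m_le : m ≤ d

namespace Spread

variable {d m : ℕ}

theorem exists_adj (h : G.Spread d m) {A B : Finset V} (hAB : Disjoint A B) (hA : d ≤ A.card)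
    (hB : m ≤ B.card) : ∃ a ∈ A, ∃ b ∈ B, G.Adj a b := h.dominate A B hAB hA hB

/-- An m-subset `B'` of `B` is anticomplete to the uncovered vertices of `S` outside `B'`, so these
number fewer than d; the other d pays for `B'` itself, as m ≤ d. -/
theorem card_nbrs (h : G.Spread d m) {B S : Finset V} (hB : m ≤ B.card) :
    S.card ≤ (G.nbrs B S).card + 2 * d := by
  classical
  obtain ⟨B', hB', hc⟩ := Finset.exists_subset_card_eq hB
  have h1 : ((S \ G.nbrs B S) \ B').card < d := by
    by_contra! hle
    obtain ⟨a, ha, b, hb, hadj⟩ := h.dominate _ B' Finset.sdiff_disjoint hle hc.ge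
    simp only [Finset.mem_sdiff, mem_nbrs, not_and, not_exists] at ha
    exact ha.1.2 ha.1.1 b (hB' hb) hadj.symm
  have h2 := Finset.le_card_sdiff B' (S \ G.nbrs B S)
  have h3 := Finset.le_card_sdiff (G.nbrs B S) S
  have := h.m_le
  omega

theorem card_nbrs_insert [DecidableEq V] (h : G.Spread d m) (b : V) (B S : Finset V) :
    (G.nbrs (insert b B) S).card ≤ (G.nbrs B S).card + d := by
  have : insert b B = {b} ∪ B := rfl
  rw [this, nbrs_union]
  have := Finset.card_union_le (G.nbrs {b} S) (G.nbrs B S)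
  have := h.degree b S
  omega

theorem card_nbrs_le_mul (h : G.Spread d m) (B S : Finset V) :
    (G.nbrs B S).card ≤ B.card * d := by
  classical
  induction B using Finset.induction_on with
  | empty => simp [nbrs]
  | insert b B hb ih =>
    have := h.card_nbrs_insert b B S
    rw [Finset.card_insert_of_notMem hb]
    linarith

/-- A set covering at least `L` vertices has a subset covering `L` vertices, up to `d`. -/
theorem exists_trim (h : G.Spread d m) {B S : Finset V} {L : ℕ} (hL : L ≤ (G.nbrs B S).card) :
    ∃ B' ⊆ B, L ≤ (G.nbrs B' S).card ∧ (G.nbrs B' S).card ≤ L + d := by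
  classical
  induction B using Finset.induction_on with
  | empty => exact ⟨∅, subset_rfl, hL, by simp [nbrs]⟩
  | insert b B hb ih =>
    by_cases hB : L ≤ (G.nbrs B S).card
    · obtain ⟨B', h1, h2⟩ := ih hB
      exact ⟨B', h1.trans (Finset.subset_insert _ _), h2⟩
    · refine ⟨_, subset_rfl, hL, ?_⟩
      have := h.card_nbrs_insert b B S
      omega

end Spread

/-! ### Parity classes and mutually private linked sets -/

theorem exists_parity_class (C : Finset V) (f : V → ℕ) :
    ∃ e, C.card ≤ 2 * (C.filter (fun x => f x % 2 = e)).card := by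
  have h := Finset.card_filter_add_card_filter_not (s := C) (fun x => f x % 2 = 0)
  have h2 : C.filter (fun x => ¬ f x % 2 = 0) = C.filter (fun x => f x % 2 = 1) :=
    Finset.filter_congr (fun x _ => by omega)
  rw [h2] at h
  by_cases h0 : C.card ≤ 2 * (C.filter (fun x => f x % 2 = 0)).card
  · exact ⟨0, h0⟩
  · exact ⟨1, by omega⟩

theorem exists_parity_class_nbrs (B W : Finset V) (g : V → ℕ) :
    ∃ e, (G.nbrs B W).card ≤ 2 * (G.nbrs (B.filter (fun x => g x % 2 = e)) W).card := by
  classical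
  have h : G.nbrs B W ⊆ G.nbrs (B.filter (fun x => g x % 2 = 0)) W ∪
      G.nbrs (B.filter (fun x => g x % 2 = 1)) W := by
    intro w hw
    obtain ⟨hw, b, hb, hadj⟩ := mem_nbrs.1 hw
    rw [Finset.mem_union]
    rcases Nat.mod_two_eq_zero_or_one (g b) with h | h
    · exact Or.inl (mem_nbrs.2 ⟨hw, b, Finset.mem_filter.2 ⟨hb, h⟩, hadj⟩)
    · exact Or.inr (mem_nbrs.2 ⟨hw, b, Finset.mem_filter.2 ⟨hb, h⟩, hadj⟩)
  have := (Finset.card_le_card h).trans (Finset.card_union_le _ _)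
  by_cases h0 : (G.nbrs B W).card ≤ 2 * (G.nbrs (B.filter (fun x => g x % 2 = 0)) W).card
  · exact ⟨0, h0⟩
  · exact ⟨1, by omega⟩

/-- Cutting `B` into `q` parts of size at most `s`, one part covers at least a `q`-th share. -/
theorem exists_chunk (W : Finset V) (s q : ℕ) (B : Finset V) (hB : B.card ≤ q * s) :
    ∃ P ⊆ B, P.card ≤ s ∧ (G.nbrs B W).card ≤ q * (G.nbrs P W).card := by
  classical
  induction q generalizing B with
  | zero =>
    have : B = ∅ := by simpa using hB
    subst this
    exact ⟨∅, subset_rfl, by simp, by simp [nbrs]⟩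
  | succ q ih =>
    obtain ⟨P, hP, hPc⟩ := Finset.exists_subset_card_eq (min_le_right s B.card)
    have h1 : (B \ P).card ≤ q * s := by
      rw [Finset.card_sdiff_of_subset hP, hPc]
      rw [Nat.add_mul, one_mul] at hB
      omega
    obtain ⟨P', hP', hP'c, hcov⟩ := ih _ h1
    have h2 : (G.nbrs B W).card ≤ (G.nbrs P W).card + q * (G.nbrs P' W).card := by
      have : B = P ∪ (B \ P) := (Finset.union_sdiff_of_subset hP).symm
      rw [this, nbrs_union]
      have h3 := Finset.card_union_le (G.nbrs P W) (G.nbrs (B \ P) W)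
      omega
    rcases le_total (G.nbrs P W).card (G.nbrs P' W).card with h | h
    · exact ⟨P', hP'.trans Finset.sdiff_subset, hP'c, by rw [Nat.add_mul, one_mul]; omega⟩
    · refine ⟨P, hP, by omega, ?_⟩
      have := Nat.mul_le_mul_left q h
      rw [Nat.add_mul, one_mul]; omega

/-- The members of `S` outside `K` without a neighbour in `K`. -/
noncomputable def far (G : SimpleGraph V) (K S : Finset V) : Finset V :=
  open Classical in S.filter (G.Detached K)

@[simp] theorem mem_far {K S : Finset V} {v : V} : v ∈ G.far K S ↔ v ∈ S ∧ G.Detached K v := by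
  simp [far]

theorem far_subset {K S : Finset V} : G.far K S ⊆ S := fun _ h => (mem_far.1 h).1

theorem card_le_card_far [DecidableEq V] (S K : Finset V) :
    S.card ≤ (G.far K S).card + (G.nbrs K S).card + (S ∩ K).card := by
  have h : S ⊆ G.far K S ∪ G.nbrs K S ∪ (S ∩ K) := by
    intro x hx
    by_cases h1 : x ∈ K
    · exact Finset.mem_union_right _ (Finset.mem_inter.2 ⟨hx, h1⟩)
    · by_cases h2 : ∃ k ∈ K, G.Adj k x
      · exact Finset.mem_union_left _ (Finset.mem_union_right _ (mem_nbrs.2 ⟨hx, h2⟩))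
      · push Not at h2
        exact Finset.mem_union_left _ (Finset.mem_union_left _ (mem_far.2 ⟨hx, h1, h2⟩))
  have h1 := Finset.card_le_card h
  have h2 := Finset.card_union_le (G.far K S ∪ G.nbrs K S) (S ∩ K)
  have h3 := Finset.card_union_le (G.far K S) (G.nbrs K S)
  omega

namespace Spread

variable {d m : ℕ}

theorem d_pos (h : G.Spread d m) : 1 ≤ d := h.m_pos.trans h.m_le

/-- Linked sets `T` and `K ∪ B`, where small parts of `B` cover little of the vertices `C`
attached to `T`, can be made private: one keeps a large part of `C` and a part of `B` that covers
much. -/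
theorem exists_private [DecidableEq V] (h : G.Spread d m) (hQ : G.CliqueIndepBound)
    {T C K B W : Finset V} {κ lam s t : ℕ}
    (hT : G.IsLinked T) (hC : ∀ c ∈ C, G.Attached T c)
    (hK : G.IsLinked K) (hKne : K.Nonempty) (hB : ∀ b ∈ B, b ∈ K ∨ ∃ k ∈ K, G.Adj k b)
    (hKB : ∀ x ∈ K ∪ B, G.Detached T x) (hW : ∀ w ∈ W, G.Detached T w)
    (hKC : (G.nbrs K C).card ≤ κ) (hKW : (G.nbrs K W).card + (W ∩ K).card ≤ κ)
    (hlam : ∀ B' ⊆ B, B'.card ≤ 2 * s → (G.nbrs B' C).card ≤ lam)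
    (hs : 1 ≤ s) (hBs : B.card ≤ 3 * t * s)
    (hCcard : 2 * lam + 5 * d + κ ≤ C.card)
    (hcov : 6 * t * m + κ + 5 * d ≤ (G.nbrs B W).card) :
    ∃ B' ⊆ B, ∃ C' ⊆ C, C.card ≤ 2 * C'.card + κ + 3 * d ∧
      (G.nbrs B W).card ≤ 2 * (G.nbrs B' W).card + κ + 4 * d ∧
      ∀ c ∈ C', G.Detached (K ∪ B') c := by
  classical
  have hd := h.d_pos
  have hCd : ∀ c ∈ C, c ∉ K ∪ B := by
    intro c hc hcKB
    obtain ⟨t, ht, hadj⟩ := (hC c hc).2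
    exact (hKB c hcKB).2 t ht hadj
  by_cases hex : ∃ a ∈ C, ∃ u ∈ K ∪ B, G.Adj u a
  swap
  · push Not at hex
    exact ⟨B, subset_rfl, C, subset_rfl, by omega, by omega,
      fun c hc => ⟨hCd c hc, fun u hu => hex c hc u hu⟩⟩
  obtain ⟨a, haC, u, huKB, hua⟩ := hex
  -- Adding the single vertex `u` makes `a` attached to both sides, as `exists_parity` requires, and
  -- covers at most d more vertices.
  set Kp := K ∪ {u} with hKp
  have hKpKB : Kp ⊆ K ∪ B := Finset.union_subset Finset.subset_union_left (by simpa using huKB)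
  have hKpl : G.IsLinked Kp := hK.union hKne (by
    intro b hb
    rw [Finset.mem_singleton] at hb
    subst hb
    rcases Finset.mem_union.1 huKB with hu | hu
    · exact Or.inl hu
    · exact hB _ hu)
  have haKp : G.Attached Kp a := ⟨fun h => hCd a haC (hKpKB h), u, by simp [hKp], hua⟩
  have hTKp : ∀ t ∈ T, G.Detached Kp t := by
    intro t ht
    refine ⟨fun hk => (hKB t (hKpKB hk)).1 ht, fun k hk hadj => ?_⟩
    exact (hKB k (hKpKB hk)).2 t ht hadj.symm
  obtain ⟨f, g, hfg⟩ := hQ.exists_parity hT hKpl (hC a haC) haKp hTKp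
  have hnb : ∀ S : Finset V, (G.nbrs (insert a Kp) S).card ≤ (G.nbrs K S).card + 2 * d := by
    intro S
    have h1 := h.card_nbrs_insert a Kp S
    have h2 := h.card_nbrs_insert u K S
    have : insert u K = Kp := by rw [hKp, Finset.union_comm]; rfl
    rw [this] at h2
    omega
  -- Parities apply only to vertices away from `a` and `Kp`; the loss is at most κ+2d neighbours and
  -- `a` itself.
  set Ca := G.far (insert a Kp) C with hCa
  have hCac : C.card ≤ Ca.card + κ + 3 * d := by
    have h1 := card_le_card_far (G := G) C (insert a Kp)
    rw [← hCa] at h1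
    have h2 := hnb C
    have h3 : C ∩ insert a Kp ⊆ {a} := by
      intro x hx
      obtain ⟨hx1, hx2⟩ := Finset.mem_inter.1 hx
      rcases Finset.mem_insert.1 hx2 with hx3 | hx3
      · simpa using hx3
      · exact absurd (hKpKB hx3) (hCd x hx1)
    have h4 := Finset.card_le_card h3
    rw [Finset.card_singleton] at h4
    omega
  obtain ⟨e, he⟩ := exists_parity_class Ca f
  set C' := Ca.filter (fun x => f x % 2 = e) with hC'
  set W' := G.far (insert a Kp) W with hW'
  have hcovW : (G.nbrs B W).card ≤ (G.nbrs (B \ Kp) W').card + κ + 4 * d := by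
    have hsub : G.nbrs B W ⊆ G.nbrs (B \ Kp) W' ∪ G.nbrs (insert a Kp) W ∪
        (W ∩ insert a Kp) := by
      intro w hw
      obtain ⟨hwW, b, hb, hadj⟩ := mem_nbrs.1 hw
      by_cases h1 : w ∈ insert a Kp
      · exact Finset.mem_union_right _ (Finset.mem_inter.2 ⟨hwW, h1⟩)
      · by_cases h2 : ∃ k ∈ insert a Kp, G.Adj k w
        · exact Finset.mem_union_left _ (Finset.mem_union_right _ (mem_nbrs.2 ⟨hwW, h2⟩))
        · push Not at h2
          refine Finset.mem_union_left _ (Finset.mem_union_left _ (mem_nbrs.2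
            ⟨mem_far.2 ⟨hwW, h1, h2⟩, b, Finset.mem_sdiff.2 ⟨hb, fun hbK => ?_⟩, hadj⟩))
          exact h2 b (Finset.mem_insert_of_mem hbK) hadj
    have h1 := Finset.card_le_card hsub
    have h2 := Finset.card_union_le (G.nbrs (B \ Kp) W' ∪ G.nbrs (insert a Kp) W)
      (W ∩ insert a Kp)
    have h3 := Finset.card_union_le (G.nbrs (B \ Kp) W') (G.nbrs (insert a Kp) W)
    have h4 := hnb W
    have h5 : (W ∩ insert a Kp).card ≤ (W ∩ K).card + 2 := by
      have : W ∩ insert a Kp ⊆ insert a (insert u (W ∩ K)) := by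
        intro x hx
        simp only [hKp, Finset.mem_inter, Finset.mem_insert, Finset.mem_union,
          Finset.mem_singleton] at hx ⊢
        tauto
      have h6 := Finset.card_le_card this
      have h7 := Finset.card_insert_le a (insert u (W ∩ K))
      have h8 := Finset.card_insert_le u (W ∩ K)
      omega
    omega
  obtain ⟨e', he'⟩ := exists_parity_class_nbrs (G := G) (B \ Kp) W' g
  set B' := (B \ Kp).filter (fun x => g x % 2 = e') with hB'
  have hB'B : B' ⊆ B := (Finset.filter_subset _ _).trans Finset.sdiff_subset
  have hC'C : C' ⊆ C := (Finset.filter_subset _ _).trans far_subset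
  have hC'prop : ∀ c ∈ C', G.Attached T c ∧ G.Detached (insert a Kp) c ∧ f c % 2 = e := by
    intro c hc
    refine ⟨hC c (hC'C hc), ?_, (Finset.mem_filter.1 hc).2⟩
    exact (mem_far.1 (Finset.mem_filter.1 hc).1).2
  have hB'prop : ∀ b ∈ B', G.Attached Kp b ∧ G.Detached T b ∧ b ≠ a ∧ g b % 2 = e' := by
    intro b hb
    have hbB := hB'B hb
    have hbK := (Finset.mem_sdiff.1 (Finset.mem_filter.1 hb).1).2
    refine ⟨⟨hbK, ?_⟩, hKB b (Finset.mem_union_right _ hbB), ?_, (Finset.mem_filter.1 hb).2⟩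
    · rcases hB b hbB with hb' | ⟨k, hk, hadj⟩
      · exact absurd (Finset.mem_union_left _ hb') hbK
      · exact ⟨k, Finset.mem_union_left _ hk, hadj⟩
    · rintro rfl
      exact hCd _ haC (Finset.mem_union_right _ hbB)
  refine ⟨B', hB'B, C', hC'C, by omega, ?_, ?_⟩
  · have := Finset.card_le_card (nbrs_mono (G := G) (subset_refl B')
      (far_subset (G := G) (K := insert a Kp) (S := W)))
    rw [← hW'] at this
    omega
  -- An edge between the parity classes `B'` and `C'` makes their parities sum to an odd number. An
  -- induced path of length two from `C'` through `W'` to `B'` would make the same sum even;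
  -- spreadness supplies one.
  by_contra hcon
  have hedge : ∃ c ∈ C', ∃ b ∈ B', G.Adj b c := by
    by_contra! hno
    refine hcon fun c hc => Detached.union ?_ ⟨fun hcB => ?_, fun b hb => hno c hc b hb⟩
    · exact (hC'prop c hc).2.1.mono
        (Finset.subset_union_left.trans (Finset.subset_insert _ _))
    · exact hCd c (hC'C hc) (Finset.mem_union_right _ (hB'B hcB))
  obtain ⟨c, hc, b, hb, hbc⟩ := hedge
  obtain ⟨P, hPB, hPc, hPcov⟩ := exists_chunk (G := G) W' s (3 * t) B'
    ((Finset.card_le_card hB'B).trans hBs)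
  -- Passing to a parity class and then to one of 3t chunks divides the coverage by at most 6t,
  -- hence the term 6tm in `hcov`.
  have hPm : m ≤ (G.nbrs P W').card := by
    by_contra! hlt
    have h1 : 3 * t * (G.nbrs P W').card ≤ 3 * t * m := Nat.mul_le_mul_left _ hlt.le
    have h2 : 6 * t * m = 2 * (3 * t * m) := by ring
    omega
  have hins : insert b P ⊆ B := Finset.insert_subset (hB'B hb) (hPB.trans hB'B)
  have hlam' := hlam _ hins (by
    have := Finset.card_insert_le b P
    omega)
  have hfar : d ≤ (C' \ G.nbrs (insert b P) C).card := by
    have := Finset.le_card_sdiff (G.nbrs (insert b P) C) C'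
    omega
  obtain ⟨x, hx, y, hy, hxy⟩ := h.exists_adj (A := C' \ G.nbrs (insert b P) C)
    (B := G.nbrs P W') (by
      rw [Finset.disjoint_left]
      intro z hz hz2
      have h1 := (hC'prop z (Finset.mem_sdiff.1 hz).1).1
      have h2 := hW z (mem_far.1 (nbrs_subset hz2)).1
      obtain ⟨t, ht, hadj⟩ := h1.2
      exact h2.2 t ht hadj) hfar hPm
  obtain ⟨hxC', hxn⟩ := Finset.mem_sdiff.1 hx
  obtain ⟨hyW', b', hb'P, hb'y⟩ := mem_nbrs.1 hy
  obtain ⟨hyW, hyd⟩ := mem_far.1 hyW'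
  have hxb' : ¬ G.Adj x b' := fun hadj =>
    hxn (mem_nbrs.2 ⟨hC'C hxC', b', Finset.mem_insert_of_mem hb'P, hadj.symm⟩)
  have hx' := hC'prop x hxC'
  have hc' := hC'prop c hc
  have hb1 := hB'prop b hb
  have hb2 := hB'prop b' (hPB hb'P)
  have r1 := (hfg c b hc'.1 hc'.2.1 hb1.1 hb1.2.1 hb1.2.2.1).1 hbc.symm
  have r2 := (hfg x b' hx'.1 hx'.2.1 hb2.1 hb2.2.1 hb2.2.2.1).2 y (hW y hyW) hyd hxy
    hb'y.symm hxb'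
  rw [Nat.odd_iff] at r1
  rw [Nat.even_iff] at r2
  omega

/-- An edge `a₁a₂` between `C₁` and `C₂` allows `exists_parity` with `K = T₂ ∪ {a₂}`. Large subsets
of the parity classes `D₁`, `D₂` span an edge, so the class parities sum to an odd number; a middle
vertex `w` of an induced path of length two would make the sum even. -/
theorem exists_pair [DecidableEq V] (h : G.Spread d m) (hQ : G.CliqueIndepBound)
    {T₁ T₂ C₁ C₂ : Finset V} (hT₁ : G.IsLinked T₁) (hT₂ : G.IsLinked T₂)
    (hT : ∀ t ∈ T₁, G.Detached T₂ t)
    (h₁ : ∀ c ∈ C₁, G.Attached T₁ c ∧ G.Detached T₂ c)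
    (h₂ : ∀ c ∈ C₂, G.Attached T₂ c ∧ G.Detached T₁ c)
    (hC₁ : 7 * d ≤ C₁.card) (hC₂ : 7 * d ≤ C₂.card) :
    ∃ a₁ a₂, ∃ D₁ ⊆ C₁, ∃ D₂ ⊆ C₂, C₁.card ≤ 2 * D₁.card + 4 * d ∧
      C₂.card ≤ 2 * D₂.card + 4 * d ∧
      ∀ E₁ ⊆ D₁, ∀ E₂ ⊆ D₂, d ≤ E₁.card → d ≤ E₂.card → ∀ x ∈ E₁, ∀ y ∈ E₂, ∀ w,
        G.Detached T₁ w → G.Detached T₂ w → G.Detached {a₁, a₂} w → G.Adj x w → G.Adj w y →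
        G.Adj x y := by
  classical
  have hd := h.d_pos
  have hm := h.m_le
  have hdisj : ∀ x ∈ C₁, x ∉ C₂ := by
    intro x hx hx2
    obtain ⟨t, ht, hadj⟩ := (h₁ x hx).1.2
    exact (h₂ x hx2).2.2 t ht hadj
  obtain ⟨a₁, ha₁, a₂, ha₂, ha⟩ := h.exists_adj
    (Finset.disjoint_left.2 hdisj) (by omega) (by omega : m ≤ C₂.card)
  have hK : G.IsLinked (T₂ ∪ {a₂}) := by
    obtain ⟨t, ht, hadj⟩ := (h₂ a₂ ha₂).1.2
    refine hT₂.union ⟨t, ht⟩ ?_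
    intro b hb
    rw [Finset.mem_singleton] at hb
    subst hb
    exact Or.inr ⟨t, ht, hadj⟩
  have haK : G.Attached (T₂ ∪ {a₂}) a₁ := by
    refine ⟨?_, a₂, by simp, ha.symm⟩
    rw [Finset.mem_union, Finset.mem_singleton]
    rintro (h0 | h0)
    · exact (h₁ a₁ ha₁).2.1 h0
    · exact ha.ne h0
  have hTK : ∀ t ∈ T₁, G.Detached (T₂ ∪ {a₂}) t := by
    intro t ht
    refine (hT t ht).union ⟨?_, ?_⟩
    · rw [Finset.mem_singleton]
      rintro rfl
      exact (h₂ _ ha₂).2.1 ht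
    · intro x hx hadj
      rw [Finset.mem_singleton] at hx
      subst hx
      exact (h₂ _ ha₂).2.2 t ht hadj.symm
  obtain ⟨f, g, hfg⟩ := hQ.exists_parity hT₁ hK (h₁ a₁ ha₁).1 haK hTK
  obtain ⟨e, he⟩ := exists_parity_class (G.far {a₁, a₂} C₁) f
  obtain ⟨e', he'⟩ := exists_parity_class (C₂.erase a₂) g
  set D₁ := (G.far {a₁, a₂} C₁).filter (fun x => f x % 2 = e) with hD₁
  set D₂ := (C₂.erase a₂).filter (fun x => g x % 2 = e') with hD₂
  have hdet : ∀ w, G.Detached T₂ w → G.Detached {a₁, a₂} w →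
      G.Detached (insert a₁ (T₂ ∪ {a₂})) w := by
    intro w hw1 hw2
    refine (hw1.union hw2).mono ?_
    intro x hx
    simp only [Finset.mem_insert, Finset.mem_union, Finset.mem_singleton] at hx ⊢
    tauto
  have hD₁C : D₁ ⊆ C₁ := (Finset.filter_subset _ _).trans far_subset
  have hD₂C : D₂ ⊆ C₂ := (Finset.filter_subset _ _).trans (Finset.erase_subset _ _)
  refine ⟨a₁, a₂, D₁, hD₁C, D₂, hD₂C, ?_, ?_, ?_⟩
  · have h1 := card_le_card_far (G := G) C₁ {a₁, a₂}
    have h2 := h.card_nbrs_le_mul {a₁, a₂} C₁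
    have h3 : ({a₁, a₂} : Finset V).card = 2 := Finset.card_pair ha.ne
    rw [h3] at h2
    have h4 : C₁ ∩ {a₁, a₂} ⊆ {a₁} := by
      intro x hx
      simp only [Finset.mem_inter, Finset.mem_insert, Finset.mem_singleton] at hx ⊢
      rcases hx.2 with h5 | h5
      · exact h5
      · exact absurd ha₂ (h5 ▸ hdisj x hx.1)
    have h5 := Finset.card_le_card h4
    rw [Finset.card_singleton] at h5
    omega
  · have := Finset.card_erase_of_mem ha₂
    omega
  · intro E₁ hE₁ E₂ hE₂ hc₁ hc₂ x hx y hy w hw₁ hw₂ hw hxw hwy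
    by_contra hxy
    have hP₁ : ∀ c ∈ E₁, G.Attached T₁ c ∧ G.Detached (insert a₁ (T₂ ∪ {a₂})) c ∧
        f c % 2 = e := by
      intro c hc
      have hcD := Finset.mem_filter.1 (hE₁ hc)
      have hcD' := mem_far.1 hcD.1
      exact ⟨(h₁ c hcD'.1).1, hdet c (h₁ c hcD'.1).2 hcD'.2, hcD.2⟩
    have hP₂ : ∀ c ∈ E₂, G.Attached (T₂ ∪ {a₂}) c ∧ G.Detached T₁ c ∧ c ≠ a₁ ∧
        g c % 2 = e' := by
      intro c hc
      have hcD := Finset.mem_filter.1 (hE₂ hc)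
      have hcD' := Finset.mem_erase.1 hcD.1
      refine ⟨⟨?_, ?_⟩, (h₂ c hcD'.2).2, ?_, hcD.2⟩
      · rw [Finset.mem_union, Finset.mem_singleton, not_or]
        exact ⟨(h₂ c hcD'.2).1.1, hcD'.1⟩
      · obtain ⟨t, ht, hadj⟩ := (h₂ c hcD'.2).1.2
        exact ⟨t, Finset.mem_union_left _ ht, hadj⟩
      · rintro rfl
        exact hdisj _ ha₁ hcD'.2
    obtain ⟨x', hx', y', hy', hadj⟩ := h.exists_adj (A := E₁) (B := E₂)
      (Finset.disjoint_left.2 fun z hz hz2 => hdisj z (hD₁C (hE₁ hz)) (hD₂C (hE₂ hz2)))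
      hc₁ (by omega)
    have p1 := hP₁ x hx
    have p2 := hP₁ x' hx'
    have q1 := hP₂ y hy
    have q2 := hP₂ y' hy'
    have r1 := (hfg x' y' p2.1 p2.2.1 q2.1 q2.2.1 q2.2.2.1).1 hadj
    have r2 := (hfg x y p1.1 p1.2.1 q1.1 q1.2.1 q1.2.2.1).2 w hw₁ (hdet w hw₂ hw) hxw hwy hxy
    rw [Nat.odd_iff] at r1
    rw [Nat.even_iff] at r2
    omega

/-- A set covering two large sets has a subset covering a good part of one of them and not too
much of the other. -/
theorem exists_minimal_cover (h : G.Spread d m) {C D E : Finset V} (hD : 1 ≤ D.card)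
    (hE : 1 ≤ E.card)
    (hC : D.card ≤ 2 * (G.nbrs C D).card ∨ E.card ≤ 2 * (G.nbrs C E).card) :
    ∃ X ⊆ C, (D.card ≤ 2 * (G.nbrs X D).card ∨ E.card ≤ 2 * (G.nbrs X E).card) ∧
      2 * (G.nbrs X D).card ≤ D.card + 2 * d ∧ 2 * (G.nbrs X E).card ≤ E.card + 2 * d := by
  classical
  induction C using Finset.induction_on with
  | empty =>
    simp only [nbrs, Finset.notMem_empty, false_and, exists_false, Finset.filter_false,
      Finset.card_empty] at hC
    omega
  | insert b B hb ih =>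
    by_cases hB : D.card ≤ 2 * (G.nbrs B D).card ∨ E.card ≤ 2 * (G.nbrs B E).card
    · obtain ⟨X, hX, h1⟩ := ih hB
      exact ⟨X, hX.trans (Finset.subset_insert _ _), h1⟩
    · refine ⟨_, subset_rfl, hC, ?_⟩
      have h1 := h.card_nbrs_insert b B D
      have h2 := h.card_nbrs_insert b B E
      omega

/-- If a set `X` covers much of `D` but not of `E`, there is an induced path of length two from
`X` to `E` through `D`. -/
theorem exists_induced_path_two (h : G.Spread d m) {X D E : Finset V} (hDE : Disjoint D E)
    (hD : m ≤ (G.nbrs X D).card) (hE : (G.nbrs X E).card + d ≤ E.card) :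
    ∃ x ∈ X, ∃ y ∈ D, ∃ z ∈ E, G.Adj x y ∧ G.Adj y z ∧ ¬ G.Adj x z := by
  classical
  have hcard := Finset.le_card_sdiff (G.nbrs X E) E
  obtain ⟨z, hz, y, hy, hadj⟩ := h.exists_adj (A := E \ G.nbrs X E) (B := G.nbrs X D)
    (Finset.disjoint_left.2 fun w hw hw2 =>
      Finset.disjoint_left.1 hDE (nbrs_subset hw2) (Finset.mem_sdiff.1 hw).1) (by omega) hD
  obtain ⟨hzE, hzn⟩ := Finset.mem_sdiff.1 hz
  obtain ⟨hyD, x, hx, hxy⟩ := mem_nbrs.1 hy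
  exact ⟨x, hx, y, hyD, z, hzE, hxy, hadj.symm, fun hxz => hzn (mem_nbrs.2 ⟨hzE, x, hx, hxz⟩)⟩

theorem card_le_card_far_pair (h : G.Spread d m) [DecidableEq V] (S : Finset V) (a b : V) :
    S.card ≤ (G.far {a, b} S).card + 4 * d := by
  have hd := h.d_pos
  have h1 := card_le_card_far (G := G) S {a, b}
  have h2 := h.card_nbrs_le_mul {a, b} S
  have h3 : ({a, b} : Finset V).card ≤ 2 := Finset.card_le_two
  have h4 := Finset.card_le_card (Finset.inter_subset_right (s₁ := S) (s₂ := {a, b}))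
  have h5 := Nat.mul_le_mul_right d h3
  omega

/-- Three mutually private linked sets cannot exist in a graph without odd holes. -/
theorem false_of_triple (h : G.Spread d m) (hQ : G.CliqueIndepBound)
    {T₁ T₂ T₃ C₁ C₂ C₃ : Finset V} (hT₁ : G.IsLinked T₁) (hT₂ : G.IsLinked T₂)
    (hT₃ : G.IsLinked T₃) (h12 : ∀ t ∈ T₁, G.Detached T₂ t) (h13 : ∀ t ∈ T₁, G.Detached T₃ t)
    (h₁ : ∀ c ∈ C₁, G.Attached T₁ c ∧ G.Detached T₂ c ∧ G.Detached T₃ c)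
    (h₂ : ∀ c ∈ C₂, G.Attached T₂ c ∧ G.Detached T₁ c ∧ G.Detached T₃ c)
    (h₃ : ∀ c ∈ C₃, G.Attached T₃ c ∧ G.Detached T₁ c ∧ G.Detached T₂ c)
    (hC₁ : 100 * d ≤ C₁.card) (hC₂ : 100 * d ≤ C₂.card) (hC₃ : 100 * d ≤ C₃.card) : False := by
  classical
  have hd := h.d_pos
  have hm := h.m_le
  obtain ⟨a₁, a₂, D₁, hD₁, D₂, hD₂, hc₁, hc₂, H12⟩ := h.exists_pair hQ hT₁ hT₂ h12
    (fun c hc => ⟨(h₁ c hc).1, (h₁ c hc).2.1⟩) (fun c hc => ⟨(h₂ c hc).1, (h₂ c hc).2.1⟩)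
    (by omega) (by omega)
  -- Starting again from `D₁` gives `E₁` both properties, towards `D₂` and towards `D₃`.
  obtain ⟨b₁, b₃, E₁, hE₁, D₃, hD₃, he₁, hc₃, H13⟩ := h.exists_pair hQ hT₁ hT₃ h13
    (C₁ := D₁) (C₂ := C₃)
    (fun c hc => ⟨(h₁ c (hD₁ hc)).1, (h₁ c (hD₁ hc)).2.2⟩)
    (fun c hc => ⟨(h₃ c hc).1, (h₃ c hc).2.1⟩) (by omega) (by omega)
  -- Vertices of `E₂` will be middle vertices for the pair 1, 3 and vertices of `E₃` for the pair 1,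
  -- 2, so each must avoid the two special vertices of that pair.
  set E₂ := G.far {b₁, b₃} D₂ with hE₂
  set E₃ := G.far {a₁, a₂} D₃ with hE₃
  have he₂ := h.card_le_card_far_pair D₂ b₁ b₃
  have he₃ := h.card_le_card_far_pair D₃ a₁ a₂
  rw [← hE₂] at he₂
  rw [← hE₃] at he₃
  have hE₂D : E₂ ⊆ D₂ := far_subset
  have hE₃D : E₃ ⊆ D₃ := far_subset
  have hdisj : Disjoint E₂ E₃ := by
    rw [Finset.disjoint_left]
    intro z hz hz3
    obtain ⟨t, ht, hadj⟩ := (h₃ z (hD₃ (hE₃D hz3))).1.2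
    exact (h₂ z (hD₂ (hE₂D hz))).2.2.2 t ht hadj
  have hcov := h.card_nbrs (B := E₁) (S := E₂) (by omega)
  -- `X` covers half of one of `E₂`, `E₃` but little more than half of the other, so an edge joins a
  -- covered vertex of the first to an uncovered vertex of the second. This completes a forbidden
  -- induced path.
  obtain ⟨X, hX, hor, hX2, hX3⟩ := h.exists_minimal_cover (C := E₁) (D := E₂) (E := E₃)
    (by omega) (by omega) (Or.inl (by omega))
  rcases hor with hor | hor
  · obtain ⟨x, hx, y, hy, z, hz, hxy, hyz, hxz⟩ := h.exists_induced_path_two hdisj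
      (X := X) (by omega) (by omega)
    refine hxz (H13 E₁ subset_rfl D₃ subset_rfl (by omega) (by omega) x (hX hx) z (hE₃D hz) y
      ?_ ?_ (mem_far.1 hy).2 hxy hyz)
    · exact (h₂ y (hD₂ (hE₂D hy))).2.1
    · exact (h₂ y (hD₂ (hE₂D hy))).2.2
  · obtain ⟨x, hx, y, hy, z, hz, hxy, hyz, hxz⟩ := h.exists_induced_path_two hdisj.symm
      (X := X) (by omega) (by omega)
    refine hxz (H12 E₁ hE₁ D₂ subset_rfl (by omega) (by omega) x (hX hx) z (hE₂D hz) y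
      ?_ ?_ (mem_far.1 hy).2 hxy hyz)
    · exact (h₃ y (hD₃ (hE₃D hy))).2.1
    · exact (h₃ y (hD₃ (hE₃D hy))).2.2

end Spread

/-! ### Balls and their growth -/

/-- The ball of radius `k` around `v`, growing inside `S`. -/
noncomputable def ballIn (G : SimpleGraph V) (S : Finset V) (v : V) : ℕ → Finset V
  | 0 => {v}
  | k + 1 => open Classical in ballIn G S v k ∪ G.nbrs (ballIn G S v k) S

theorem ballIn_succ [DecidableEq V] (S : Finset V) (v : V) (k : ℕ) :
    G.ballIn S v (k + 1) = G.ballIn S v k ∪ G.nbrs (G.ballIn S v k) S := by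
  ext x
  simp [ballIn]

theorem ballIn_subset_succ (S : Finset V) (v : V) (k : ℕ) :
    G.ballIn S v k ⊆ G.ballIn S v (k + 1) := by
  classical
  rw [ballIn_succ]
  exact Finset.subset_union_left

theorem ballIn_mono (S : Finset V) (v : V) {k l : ℕ} (h : k ≤ l) :
    G.ballIn S v k ⊆ G.ballIn S v l :=
  monotone_nat_of_le_succ (ballIn_subset_succ S v) h

theorem nbrs_ballIn_subset (S : Finset V) (v : V) (k : ℕ) :
    G.nbrs (G.ballIn S v k) S ⊆ G.ballIn S v (k + 1) := by
  classical
  rw [ballIn_succ]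
  exact Finset.subset_union_right

theorem mem_ballIn_self (S : Finset V) (v : V) (k : ℕ) : v ∈ G.ballIn S v k :=
  ballIn_mono S v (Nat.zero_le k) (by simp [ballIn])

theorem ballIn_subset {S : Finset V} {v : V} (hv : v ∈ S) (k : ℕ) : G.ballIn S v k ⊆ S := by
  classical
  induction k with
  | zero => simpa [ballIn] using hv
  | succ k ih =>
    rw [ballIn_succ]
    exact Finset.union_subset ih nbrs_subset

theorem ballIn_mono_set {S S' : Finset V} (h : S ⊆ S') (v : V) (k : ℕ) :
    G.ballIn S v k ⊆ G.ballIn S' v k := by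
  classical
  induction k with
  | zero => simp [ballIn]
  | succ k ih =>
    rw [ballIn_succ, ballIn_succ]
    exact Finset.union_subset_union ih (nbrs_mono ih h)

theorem attached_of_mem_ballIn_succ {S : Finset V} {v : V} {k : ℕ} {b : V}
    (hb : b ∈ G.ballIn S v (k + 1)) : b ∈ G.ballIn S v k ∨ ∃ x ∈ G.ballIn S v k, G.Adj x b := by
  classical
  rw [ballIn_succ, Finset.mem_union, mem_nbrs] at hb
  exact hb.imp id fun h => h.2

theorem isLinked_ballIn (S : Finset V) (v : V) (k : ℕ) : G.IsLinked (G.ballIn S v k) := by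
  classical
  induction k with
  | zero => exact isLinked_singleton v
  | succ k ih =>
    rw [ballIn_succ]
    exact ih.union ⟨v, mem_ballIn_self S v k⟩ fun b hb => Or.inr (mem_nbrs.1 hb).2

/-- The path to the common vertex is walked backwards. In a maximal packing of ρ-balls this makes
the concentric 2ρ-balls cover all candidate centres. -/
theorem mem_ballIn_of_mem_of_mem {S : Finset V} {u v : V} (hu : u ∈ S) (i : ℕ) :
    ∀ (j : ℕ) (w : V), w ∈ G.ballIn S u i → w ∈ G.ballIn S v j → u ∈ G.ballIn S v (j + i) := by
  induction i with
  | zero =>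
    intro j w hw hv
    simp only [ballIn, Finset.mem_singleton] at hw
    subst hw
    exact hv
  | succ i ih =>
    intro j w hw hv
    rcases attached_of_mem_ballIn_succ hw with h | ⟨x, hx, hadj⟩
    · exact ballIn_mono S v (by omega) (ih j w h hv)
    · have hxS := ballIn_subset hu i hx
      have := ih (j + 1) x hx (nbrs_ballIn_subset S v j (mem_nbrs.2 ⟨hxS, w, hv, hadj.symm⟩))
      rwa [show j + (i + 1) = j + 1 + i by omega]

namespace Spread

variable {d m : ℕ}

/-- Large sets contain large balls of bounded radius. -/
theorem exists_large_ball (h : G.Spread d m) {t L : ℕ} (ht : 1 ≤ t) (htm : 2 * m * t ≤ d)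
    (hL : 1 ≤ L) (i : ℕ) : ∀ S : Finset V, (i + 1) * (L + 3 * d) ≤ S.card →
      ∃ v ∈ S, min (t ^ i) L ≤ (G.ballIn S v (2 ^ i - 1)).card := by
  classical
  induction i with
  | zero =>
    intro S hS
    obtain ⟨v, hv⟩ : S.Nonempty := by
      rw [← Finset.card_pos]
      omega
    exact ⟨v, hv, by simp [ballIn]⟩
  | succ i ih =>
    intro S hS
    by_contra! hcon
    set ρ := 2 ^ i - 1 with hρ
    have hρ' : 2 ^ (i + 1) - 1 = 2 * ρ + 1 := by
      have := Nat.one_le_two_pow (n := i)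
      rw [pow_succ]
      omega
    rw [hρ'] at hcon
    have hconL : ∀ v ∈ S, (G.ballIn S v (2 * ρ + 1)).card < L :=
      fun v hv => (hcon v hv).trans_le (min_le_right _ _)
    have hcont : ∀ v ∈ S, (G.ballIn S v (2 * ρ + 1)).card < t ^ (i + 1) :=
      fun v hv => (hcon v hv).trans_le (min_le_left _ _)
    set good := S.filter (fun v => min (t ^ i) L ≤ (G.ballIn S v ρ).card) with hgood
    have hgS : good ⊆ S := Finset.filter_subset _ _
    -- Otherwise the bad vertices are numerous enough for the induction hypothesis, which finds a
    -- good one among them.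
    have hgc : L + 3 * d ≤ good.card := by
      by_contra! hlt
      set bad := S.filter (fun v => ¬ min (t ^ i) L ≤ (G.ballIn S v ρ).card) with hbad
      have hsum : good.card + bad.card = S.card :=
        Finset.card_filter_add_card_filter_not _
      obtain ⟨v, hv, hvb⟩ := ih bad (by
        rw [Nat.add_mul (i + 1) 1, one_mul] at hS
        omega)
      have h1 := Finset.card_le_card (ballIn_mono_set (G := G) (Finset.filter_subset _ S) v ρ :
        G.ballIn bad v ρ ⊆ G.ballIn S v ρ)
      exact (Finset.mem_filter.1 hv).2 (hvb.trans h1)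
    have hSc : L + 3 * d ≤ S.card := hgc.trans (Finset.card_le_card hgS)
    obtain ⟨v₀, hv₀⟩ : good.Nonempty := by
      rw [← Finset.card_pos]
      omega
    have htL : t ^ i < L := by
      by_contra! hle
      have h1 := (Finset.mem_filter.1 hv₀).2
      rw [min_eq_right hle] at h1
      have h2 := Finset.card_le_card (ballIn_mono (G := G) S v₀ (show ρ ≤ 2 * ρ + 1 by omega))
      have h3 := hconL v₀ (hgS hv₀)
      omega
    have hgball : ∀ v ∈ good, t ^ i ≤ (G.ballIn S v ρ).card := by
      intro v hv
      have h1 := (Finset.mem_filter.1 hv).2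
      rwa [min_eq_left htL.le] at h1
    rcases le_or_gt m (t ^ i) with hmt | hmt
    -- With m vertices the ball already reaches all but 2d of `S` in one more step.
    · have h1 := h.card_nbrs (B := G.ballIn S v₀ ρ) (S := S) (hmt.trans (hgball v₀ hv₀))
      have h2 := Finset.card_le_card ((nbrs_ballIn_subset S v₀ ρ).trans
        (ballIn_mono (G := G) S v₀ (show ρ + 1 ≤ 2 * ρ + 1 by omega)))
      have h3 := hconL v₀ (hgS hv₀)
      omega
    -- A maximal family of disjoint ρ-balls around good centres: enlarging the radii to 2ρ+1 covers
    -- all good vertices.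
    · let Pk : Finset V → Prop := fun F => F ⊆ good ∧
        ∀ x ∈ F, ∀ y ∈ F, x ≠ y → Disjoint (G.ballIn S x ρ) (G.ballIn S y ρ)
      obtain ⟨F, hF, hFmax⟩ := Finset.exists_max_image (good.powerset.filter Pk) Finset.card
        ⟨∅, by simp [Pk]⟩
      have hF' : Pk F := (Finset.mem_filter.1 hF).2
      have hcover : good ⊆ F.biUnion (fun f => G.ballIn S f (2 * ρ + 1)) := by
        intro x hx
        rw [Finset.mem_biUnion]
        by_contra! hno
        have hxF : x ∉ F := fun hxF => hno x hxF (mem_ballIn_self S x _)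
        have hdis : ∀ y ∈ F, Disjoint (G.ballIn S x ρ) (G.ballIn S y ρ) := by
          intro y hy
          rw [Finset.disjoint_left]
          intro w hw1 hw2
          refine hno y hy (ballIn_mono S y ?_ (mem_ballIn_of_mem_of_mem (hgS hx) ρ ρ w hw1 hw2))
          omega
        have hP : Pk (insert x F) := by
          refine ⟨Finset.insert_subset hx hF'.1, ?_⟩
          intro a ha b hb hab
          rcases Finset.mem_insert.1 ha with ha' | ha' <;>
            rcases Finset.mem_insert.1 hb with hb' | hb'
          · exact absurd (ha'.trans hb'.symm) hab
          · exact ha' ▸ hdis b hb'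
          · exact hb' ▸ (hdis a ha').symm
          · exact hF'.2 a ha' b hb' hab
        have := hFmax (insert x F) (Finset.mem_filter.2 ⟨Finset.mem_powerset.2 hP.1, hP⟩)
        rw [Finset.card_insert_of_notMem hxF] at this
        omega
      have hcard : good.card ≤ F.card * t ^ (i + 1) :=
        (Finset.card_le_card hcover).trans (Finset.card_biUnion_le_card_mul _ _ _
          fun f hf => (hcont f (hgS (hF'.1 hf))).le)
      -- This many balls hold at least m vertices, hence reach all but 2d of `S`; yet their
      -- enlargements hold at most 2mt ≤ d vertices in total.
      set k := m / t ^ i + 1 with hk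
      have htpos : 0 < t ^ i := Nat.pow_pos ht
      have hk1 : m ≤ k * t ^ i := by
        have := Nat.div_add_mod m (t ^ i)
        have h2 := Nat.mod_lt m htpos
        rw [hk, Nat.add_mul, one_mul, mul_comm]
        omega
      have hk2 : k * t ^ (i + 1) ≤ d := by
        have h1 := Nat.div_mul_le_self m (t ^ i)
        calc k * t ^ (i + 1) = (m / t ^ i * t ^ i + t ^ i) * t := by rw [hk]; ring
          _ ≤ (m + m) * t := Nat.mul_le_mul_right _ (by omega)
          _ = 2 * m * t := by ring
          _ ≤ d := htm
      have hkF : k ≤ F.card := by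
        by_contra! hlt
        have := Nat.mul_le_mul_right (t ^ (i + 1)) hlt.le
        have hd := h.d_pos
        omega
      obtain ⟨F', hF'F, hF'c⟩ := Finset.exists_subset_card_eq hkF
      set U := F'.biUnion (fun f => G.ballIn S f ρ) with hU
      have hUc : m ≤ U.card := by
        rw [hU, Finset.card_biUnion fun x hx y hy hxy =>
          hF'.2 x (hF'F hx) y (hF'F hy) hxy]
        refine hk1.trans ?_
        rw [← hF'c, ← smul_eq_mul]
        exact Finset.card_nsmul_le_sum _ _ _ fun f hf => hgball f (hF'.1 (hF'F hf))
      have h1 := h.card_nbrs (S := S) hUc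
      have h2 : G.nbrs U S ⊆ F'.biUnion (fun f => G.ballIn S f (2 * ρ + 1)) := by
        intro x hx
        obtain ⟨hxS, b, hb, hadj⟩ := mem_nbrs.1 hx
        obtain ⟨f, hf, hbf⟩ := Finset.mem_biUnion.1 hb
        refine Finset.mem_biUnion.2 ⟨f, hf, ballIn_mono S f (show ρ + 1 ≤ 2 * ρ + 1 by omega) ?_⟩
        exact nbrs_ballIn_subset S f ρ (mem_nbrs.2 ⟨hxS, b, hbf, hadj⟩)
      have h3 := (Finset.card_le_card h2).trans (Finset.card_biUnion_le_card_mul _ _ _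
        fun f hf => (hcont f (hgS (hF'.1 (hF'F hf)))).le)
      rw [hF'c] at h3
      omega

end Spread

/-! ### Stabilising the radius and the covering cost -/

theorem exists_last_true {P : ℕ → Prop} {q : ℕ} (h0 : P 0) (hq : ¬ P q) :
    ∃ j < q, P j ∧ ¬ P (j + 1) := by
  by_contra! h
  have : ∀ j ≤ q, P j := by
    intro j
    induction j with
    | zero => exact fun _ => h0
    | succ j ih => exact fun hj => h j hj (ih (by omega))
  exact hq (this q le_rfl)

theorem detached_comm {A B : Finset V} (h : ∀ x ∈ A, G.Detached B x) :
    ∀ y ∈ B, G.Detached A y :=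
  fun y hy => ⟨fun hyA => (h y hyA).1 hy, fun x hx hadj => (h x hx).2 y hy hadj.symm⟩

theorem isLinked_ballIn_union [DecidableEq V] {W B : Finset V} {v : V} {k : ℕ}
    (hB : B ⊆ G.ballIn W v (k + 1)) : G.IsLinked (G.ballIn W v k ∪ B) :=
  (isLinked_ballIn W v k).union ⟨v, mem_ballIn_self W v k⟩
    fun _ hb => attached_of_mem_ballIn_succ (hB hb)

theorem attached_ballIn_union [DecidableEq V] {W B : Finset V} {v : V} {k : ℕ}
    (hB : B ⊆ G.ballIn W v (k + 1)) {c : V} (hc : c ∈ G.nbrs B W \ G.ballIn W v (k + 1)) :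
    G.Attached (G.ballIn W v k ∪ B) c := by
  obtain ⟨hc1, hc2⟩ := Finset.mem_sdiff.1 hc
  obtain ⟨-, b, hb, hadj⟩ := mem_nbrs.1 hc1
  refine ⟨fun h => hc2 ?_, b, Finset.mem_union_right _ hb, hadj⟩
  exact Finset.union_subset (ballIn_subset_succ W v k) hB h

theorem detached_ballIn_union [DecidableEq V] {W B : Finset V} {v : V} {k : ℕ}
    (hB : B ⊆ G.ballIn W v (k + 1)) {w : V}
    (hw : w ∈ (W \ G.ballIn W v (k + 1)) \ G.nbrs B W) : G.Detached (G.ballIn W v k ∪ B) w := by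
  obtain ⟨hw1, hw2⟩ := Finset.mem_sdiff.1 hw
  obtain ⟨hwW, hw3⟩ := Finset.mem_sdiff.1 hw1
  refine ⟨fun h => hw3 (Finset.union_subset (ballIn_subset_succ W v k) hB h), fun t ht hadj => ?_⟩
  rcases Finset.mem_union.1 ht with ht | ht
  · exact hw3 (nbrs_ballIn_subset W v k (mem_nbrs.2 ⟨hwW, t, ht, hadj⟩))
  · exact hw2 (mem_nbrs.2 ⟨hwW, t, ht, hadj⟩)

/-- Every set contained in `S` that misses at most `E` members of `S` contains some `v` and a part
`B` of the ball of radius `r` around `v`, with `|B| < 3 t ^ (j + 1)`, that covers at least `L`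
vertices; but no part of size less than `3 t ^ j` of such a ball in `S` covers `L` vertices. -/
def StableCost (G : SimpleGraph V) (r t j L E : ℕ) (S : Finset V) : Prop :=
  (∀ v ∈ S, ∀ B ⊆ G.ballIn S v r, B.card < 3 * t ^ j → (G.nbrs B S).card < L) ∧
  ∀ S' ⊆ S, S.card ≤ S'.card + E → ∃ v ∈ S', ∃ B ⊆ G.ballIn S' v r,
    B.card < 3 * t ^ (j + 1) ∧ L ≤ (G.nbrs B S').card

theorem StableCost.mono {r t j L E E' : ℕ} {S S' : Finset V}
    (h : G.StableCost r t j L (E + E') S) (hS : S' ⊆ S) (hc : S.card ≤ S'.card + E) :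
    G.StableCost r t j L E' S' := by
  constructor
  · intro v hv B hB hBc
    exact (Finset.card_le_card (nbrs_mono subset_rfl hS)).trans_lt
      (h.1 v (hS hv) B (hB.trans (ballIn_mono_set hS v r)) hBc)
  · intro S'' hS'' hc''
    exact h.2 S'' (hS''.trans hS) (by omega)

namespace Spread

variable {d m : ℕ}

/-- The bound 2dX^k on (k+1)-balls holds for k = 0 by the degree condition. At k = 2^q no admissible
set satisfies it, by `exists_large_ball`, since t^q exceeds the number of vertices. The last k for
which some set missing at most kE vertices satisfies it is the stable radius. -/
theorem exists_stable_radius [Fintype V] (h : G.Spread d m) {t q X E : ℕ} (ht : 1 ≤ t)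
    (htm : 2 * m * t ≤ d) (htq : Fintype.card V < t ^ q)
    (hV : 2 ^ q * E + (q + 1) * (2 * d * X ^ (2 ^ q) + 1 + 3 * d) ≤ Fintype.card V) :
    ∃ k < 2 ^ q, ∃ S, (∀ v ∈ S, (G.ballIn S v (k + 1)).card ≤ 2 * d * X ^ k) ∧
      ∀ S' ⊆ S, S.card ≤ S'.card + E →
        ∃ v ∈ S', 2 * d * X ^ (k + 1) < (G.ballIn S' v (k + 2)).card := by
  classical
  let P : ℕ → Prop := fun k => ∃ S : Finset V, Fintype.card V ≤ S.card + k * E ∧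
    ∀ v ∈ S, (G.ballIn S v (k + 1)).card ≤ 2 * d * X ^ k
  have h0 : P 0 := by
    refine ⟨Finset.univ, by simp, fun v _ => ?_⟩
    rw [ballIn_succ]
    have h1 := Finset.card_union_le (G.ballIn Finset.univ v 0)
      (G.nbrs (G.ballIn Finset.univ v 0) Finset.univ)
    have h2 := h.degree v Finset.univ
    have h3 := h.d_pos
    simp only [ballIn, Finset.card_singleton, pow_zero, mul_one] at h1 ⊢
    omega
  have hR : ¬ P (2 ^ q) := by
    rintro ⟨S, hS, hball⟩
    obtain ⟨v, hv, hvb⟩ := h.exists_large_ball ht htm (L := 2 * d * X ^ (2 ^ q) + 1)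
      (by omega) q S (by omega)
    have h1 := Finset.card_le_univ (G.ballIn S v (2 ^ q - 1))
    have h2 := hball v hv
    have h3 := Finset.card_le_card (ballIn_mono (G := G) S v
      (show 2 ^ q - 1 ≤ 2 ^ q + 1 from (Nat.sub_le _ _).trans (Nat.le_succ _)))
    rcases min_le_iff.1 hvb with h4 | h4 <;> omega
  obtain ⟨k, hk, ⟨S, hS, hball⟩, hnot⟩ := exists_last_true h0 hR
  refine ⟨k, hk, S, hball, fun S' hS' hc => ?_⟩
  by_contra! hcon
  exact hnot ⟨S', by rw [Nat.add_mul, one_mul]; omega, hcon⟩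

/-- The same device with the cost exponent in place of the radius: two vertices cover at most 2d <
L, while every ball has fewer than t^q vertices and some ball covers L. -/
theorem exists_stableCost [Fintype V] (h : G.Spread d m) {t q r L E : ℕ} {S : Finset V}
    (hL : 2 * d < L) (htq : Fintype.card V < t ^ q)
    (hS : ∀ S' ⊆ S, S.card ≤ S'.card + q * E → ∃ v ∈ S', L ≤ (G.nbrs (G.ballIn S' v r) S').card) :
    ∃ j, ∃ S' ⊆ S, S.card ≤ S'.card + (q - 1) * E ∧ G.StableCost r t j L E S' := by
  classical
  let P : ℕ → Prop := fun j => ∃ S' ⊆ S, S.card ≤ S'.card + j * E ∧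
    ∀ v ∈ S', ∀ B ⊆ G.ballIn S' v r, B.card < 3 * t ^ j → (G.nbrs B S').card < L
  have h0 : P 0 := by
    refine ⟨S, subset_rfl, by simp, fun v _ B _ hBc => ?_⟩
    have h1 := h.card_nbrs_le_mul B S
    rw [pow_zero] at hBc
    have h2 : B.card * d ≤ 2 * d := Nat.mul_le_mul_right d (by omega)
    omega
  have hq : ¬ P q := by
    rintro ⟨S', hS', hc, hB⟩
    obtain ⟨v, hv, hvL⟩ := hS S' hS' hc
    have h1 := Finset.card_le_univ (G.ballIn S' v r)
    have := hB v hv _ subset_rfl (by omega)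
    omega
  obtain ⟨j, hj, ⟨S', hS', hc, ha⟩, hnot⟩ := exists_last_true h0 hq
  refine ⟨j, S', hS', ?_, ha, ?_⟩
  · have : j * E ≤ (q - 1) * E := Nat.mul_le_mul_right E (by omega)
    omega
  · intro S'' hS'' hc''
    by_contra! hcon
    exact hnot ⟨S'', hS''.trans hS', by rw [Nat.add_mul, one_mul]; omega, hcon⟩

/-- There is a set in which all relevant covering costs are stable under removing `E` vertices. -/
theorem exists_stable [Fintype V] (h : G.Spread d m) {t q X E : ℕ} (ht : 1 ≤ t) (hq : 1 ≤ q)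
    (htm : 2 * m * t ≤ d) (htq : Fintype.card V < t ^ q) (hX : 10 ^ 8 ≤ X)
    (hE : E = 2 * d * X ^ (2 ^ q))
    (hV : 2 ^ q * ((q + 1) * (q + 1) * E) + (q + 1) * (E + 1 + 3 * d) ≤ Fintype.card V) :
    ∃ k κ S i j, 2 * d ≤ κ ∧ X * κ ≤ E ∧ (∀ v ∈ S, (G.ballIn S v (k + 1)).card ≤ κ) ∧
      (∀ S' ⊆ S, S.card ≤ S'.card + E → ∃ v ∈ S', X * κ < (G.ballIn S' v (k + 2)).card) ∧
      G.StableCost (k + 1) t i (10 ^ 5 * κ) E S ∧ G.StableCost (k + 1) t j (10 ^ 3 * κ) E S := by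
  classical
  -- The two cost stages delete at most (q-1)(q+1)E and (q-1)E vertices; the budget (q+1)²E leaves
  -- stability under E further deletions.
  obtain ⟨k, hk, S, hball, hbig⟩ := h.exists_stable_radius (X := X)
    (E := (q + 1) * (q + 1) * E) ht htm htq (by rw [← hE]; exact hV)
  set κ := 2 * d * X ^ k with hκ
  have hXκ : 2 * d * X ^ (k + 1) = X * κ := by rw [hκ]; ring
  rw [hXκ] at hbig
  have hd := h.d_pos
  have hκd : 2 * d ≤ κ := Nat.le_mul_of_pos_right _ (Nat.pow_pos (by omega))
  have hXE : X * κ ≤ E := by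
    rw [← hXκ, hE]
    exact Nat.mul_le_mul_left _ (Nat.pow_le_pow_right (by omega) hk)
  have hXκ' : 10 ^ 8 * κ ≤ X * κ := Nat.mul_le_mul_right κ hX
  obtain ⟨p, rfl⟩ : ∃ p, q = p + 1 := ⟨q - 1, by omega⟩
  have hcov : ∀ S' ⊆ S, S.card ≤ S'.card + (p + 1 + 1) * (p + 1 + 1) * E → ∃ v ∈ S',
      10 ^ 5 * κ ≤ (G.nbrs (G.ballIn S' v (k + 1)) S').card := by
    intro S' hS' hc
    obtain ⟨v, hv, hvc⟩ := hbig S' hS' hc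
    refine ⟨v, hv, ?_⟩
    have h1 := hball v (hS' hv)
    have h2 := Finset.card_le_card (ballIn_mono_set (G := G) hS' v (k + 1))
    rw [ballIn_succ S' v (k + 1)] at hvc
    have h3 := Finset.card_union_le (G.ballIn S' v (k + 1)) (G.nbrs (G.ballIn S' v (k + 1)) S')
    omega
  obtain ⟨i, S₁, hS₁, hc₁, hcost₁⟩ := h.exists_stableCost (q := p + 1) (r := k + 1)
    (L := 10 ^ 5 * κ) (E := (p + 1 + 1) * E) (S := S) (by omega) htq (by
      intro S' hS' hc
      refine hcov S' hS' (hc.trans (Nat.add_le_add_left ?_ _))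
      rw [mul_assoc]
      exact Nat.mul_le_mul_right _ (by omega))
  rw [Nat.add_sub_cancel] at hc₁
  obtain ⟨j, S₂, hS₂, hc₂, hcost₂⟩ := h.exists_stableCost (q := p + 1) (r := k + 1)
    (L := 10 ^ 3 * κ) (E := E) (S := S₁) (by omega) htq (by
      intro S' hS' hc
      obtain ⟨v, hv, hvc⟩ := hcov S' (hS'.trans hS₁) (by nlinarith [Nat.zero_le (p * E)])
      exact ⟨v, hv, by omega⟩)
  rw [Nat.add_sub_cancel] at hc₂
  refine ⟨k, κ, S₂, i, j, hκd, hXE, ?_, ?_, ?_, hcost₂⟩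
  · intro v hv
    exact (Finset.card_le_card (ballIn_mono_set (hS₂.trans hS₁) v (k + 1))).trans
      (hball v (hS₁ (hS₂ hv)))
  · intro S' hS' hc
    exact hbig S' (hS'.trans (hS₂.trans hS₁)) (by nlinarith [Nat.zero_le (p * E)])
  · have hcost : G.StableCost (k + 1) t i (10 ^ 5 * κ) (p * E + (2 * E)) S₁ := by
      rwa [show p * E + 2 * E = (p + 1 + 1) * E by ring]
    have := hcost.mono hS₂ hc₂
    exact ⟨this.1, fun S' hS' hc => this.2 S' hS' (by omega)⟩

/-! ### Construction of three mutually private linked sets -/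

/-- A large graph without odd holes cannot be spread if `d` is much larger than `m`. -/
theorem false_of_large [Fintype V] (h : G.Spread d m) (hQ : G.CliqueIndepBound) {t q X E : ℕ}
    (ht : 1 ≤ t) (hq : 1 ≤ q) (htm : 6 * t * m ≤ d) (htq : Fintype.card V < t ^ q)
    (hX : 10 ^ 8 ≤ X) (hE : E = 2 * d * X ^ (2 ^ q))
    (hV : 2 ^ q * ((q + 1) * (q + 1) * E) + (q + 1) * (E + 1 + 3 * d) ≤ Fintype.card V) :
    False := by
  classical
  have htm' : 2 * m * t ≤ d := by
    have h1 : 6 * t * m = 3 * (2 * m * t) := by ring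
    omega
  obtain ⟨k, κ, S, i, j, hκd, hXE, hball, hbig, hcost₂, hcost₃⟩ :=
    h.exists_stable ht hq htm' htq hX hE hV
  have hd := h.d_pos
  have hXκ' : 10 ^ 8 * κ ≤ X * κ := Nat.mul_le_mul_right κ hX
  have hball' : ∀ W ⊆ S, ∀ v ∈ W, (G.ballIn W v (k + 1)).card ≤ κ := fun W hW v hv =>
    (Finset.card_le_card (ballIn_mono_set hW v (k + 1))).trans (hball v (hW hv))
  have hcore : ∀ W ⊆ S, ∀ v ∈ W, ∀ C ⊆ S, (G.nbrs (G.ballIn W v k) C).card ≤ κ := by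
    intro W hW v hv C hC
    refine (Finset.card_le_card ?_).trans (hball v (hW hv))
    exact (nbrs_mono (ballIn_mono_set hW v k) hC).trans (nbrs_ballIn_subset S v k)
  have hcore' : ∀ W ⊆ S, ∀ v ∈ W, ∀ C ⊆ S,
      (G.nbrs (G.ballIn W v k) C).card + (C ∩ G.ballIn W v k).card ≤ 2 * κ := by
    intro W hW v hv C hC
    have h1 := hcore W hW v hv C hC
    have h2 := Finset.card_le_card ((Finset.inter_subset_right (s₁ := C)).trans
      (ballIn_subset_succ (G := G) W v k))
    have h3 := hball' W hW v hv
    omega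
  -- the first linked set
  obtain ⟨v₁, hv₁, hv₁c⟩ := hbig S subset_rfl (by omega)
  -- The scales 10^7, 10^5, 10^3 are a factor 100 apart: a set of neighbours that has been halved
  -- still dwarfs what a small part of a later ball covers.
  obtain ⟨B₁, hB₁, hB₁l, hB₁u⟩ := h.exists_trim (B := G.ballIn S v₁ (k + 1)) (S := S)
    (L := 10 ^ 7 * κ) (by
      have h1 := hball v₁ hv₁
      rw [ballIn_succ S v₁ (k + 1)] at hv₁c
      have h3 := Finset.card_union_le (G.ballIn S v₁ (k + 1))
        (G.nbrs (G.ballIn S v₁ (k + 1)) S)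
      omega)
  set T₁ := G.ballIn S v₁ k ∪ B₁ with hT₁
  set C₁ := G.nbrs B₁ S \ G.ballIn S v₁ (k + 1) with hC₁
  set W₁ := (S \ G.ballIn S v₁ (k + 1)) \ G.nbrs B₁ S with hW₁
  have hT₁l : G.IsLinked T₁ := isLinked_ballIn_union hB₁
  have hC₁a : ∀ c ∈ C₁, G.Attached T₁ c := fun c hc => attached_ballIn_union hB₁ hc
  have hW₁d : ∀ w ∈ W₁, G.Detached T₁ w := fun w hw => detached_ballIn_union hB₁ hw
  have hW₁S : W₁ ⊆ S := Finset.sdiff_subset.trans Finset.sdiff_subset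
  have hC₁S : C₁ ⊆ S := Finset.sdiff_subset.trans nbrs_subset
  have hC₁c : 10 ^ 7 * κ ≤ C₁.card + κ := by
    have h1 := Finset.le_card_sdiff (G.ballIn S v₁ (k + 1)) (G.nbrs B₁ S)
    rw [← hC₁] at h1
    have h2 := hball v₁ hv₁
    omega
  have hW₁c : S.card ≤ W₁.card + 10 ^ 7 * κ + d + κ := by
    have h1 := Finset.le_card_sdiff (G.nbrs B₁ S) (S \ G.ballIn S v₁ (k + 1))
    rw [← hW₁] at h1
    have h2 := Finset.le_card_sdiff (G.ballIn S v₁ (k + 1)) S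
    have h3 := hball v₁ hv₁
    omega
  -- the second linked set
  obtain ⟨v₂, hv₂, B₂', hB₂', hB₂c', hB₂cov'⟩ := hcost₂.2 W₁ hW₁S (by omega)
  obtain ⟨B₂, hB₂B, hB₂l, hB₂u⟩ := h.exists_trim hB₂cov'
  have hB₂ := hB₂B.trans hB₂'
  have hB₂c := (Finset.card_le_card hB₂B).trans_lt hB₂c'
  have hKB₂ : G.ballIn W₁ v₂ k ∪ B₂ ⊆ W₁ := Finset.union_subset (ballIn_subset hv₂ k)
    (hB₂.trans (ballIn_subset hv₂ _))
  -- Later sets live in `W₁`, away from `T₁`, so only contact between `C₁` and the new linked set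
  -- has to be removed. Stable cost gives the bound `lam`: parts of at most 2t^i < 3t^i vertices
  -- cover less than 10^5 κ.
  obtain ⟨D₂, hD₂, C₁', hC₁', hC₁'c, hD₂cov, hpriv₁₂⟩ := h.exists_private hQ
    (T := T₁) (C := C₁) (K := G.ballIn W₁ v₂ k) (B := B₂) (W := W₁) (κ := 2 * κ)
    (lam := 10 ^ 5 * κ) (s := t ^ i) (t := t) hT₁l hC₁a (isLinked_ballIn W₁ v₂ k)
    ⟨v₂, mem_ballIn_self W₁ v₂ k⟩ (fun b hb => attached_of_mem_ballIn_succ (hB₂ hb))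
    (fun x hx => hW₁d x (hKB₂ hx)) hW₁d
    ((hcore W₁ hW₁S v₂ hv₂ C₁ hC₁S).trans (by omega)) (hcore' W₁ hW₁S v₂ hv₂ W₁ hW₁S)
    (by
      intro B' hB' hB'c
      have h1 : 0 < t ^ i := Nat.pow_pos ht
      have h2 := hcost₂.1 v₂ (hW₁S hv₂) B'
        (hB'.trans (hB₂.trans (ballIn_mono_set hW₁S v₂ _))) (by omega)
      exact (Finset.card_le_card (nbrs_mono subset_rfl hC₁S)).trans h2.le)
    (Nat.pow_pos ht) (by rw [pow_succ] at hB₂c; linarith) (by omega) (by omega)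
  have hD₂b := hD₂.trans hB₂
  set T₂ := G.ballIn W₁ v₂ k ∪ D₂ with hT₂
  have hT₂W : T₂ ⊆ W₁ := (Finset.union_subset_union subset_rfl hD₂).trans hKB₂
  set C₂ := G.nbrs D₂ W₁ \ G.ballIn W₁ v₂ (k + 1) with hC₂
  set W₂ := (W₁ \ G.ballIn W₁ v₂ (k + 1)) \ G.nbrs B₂ W₁ with hW₂
  have hT₂l : G.IsLinked T₂ := isLinked_ballIn_union hD₂b
  have hC₂a : ∀ c ∈ C₂, G.Attached T₂ c := fun c hc => attached_ballIn_union hD₂b hc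
  have hW₂d : ∀ w ∈ W₂, G.Detached T₂ w := fun w hw =>
    (detached_ballIn_union hB₂ hw).mono (Finset.union_subset_union subset_rfl hD₂)
  have hW₂W : W₂ ⊆ W₁ := Finset.sdiff_subset.trans Finset.sdiff_subset
  have hW₂S := hW₂W.trans hW₁S
  have hC₂W : C₂ ⊆ W₁ := Finset.sdiff_subset.trans nbrs_subset
  have hC₂S := hC₂W.trans hW₁S
  have hC₂c : (G.nbrs D₂ W₁).card ≤ C₂.card + κ := by
    have h1 := Finset.le_card_sdiff (G.ballIn W₁ v₂ (k + 1)) (G.nbrs D₂ W₁)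
    rw [← hC₂] at h1
    have h2 := hball' W₁ hW₁S v₂ hv₂
    omega
  have hW₂c : W₁.card ≤ W₂.card + 10 ^ 5 * κ + d + κ := by
    have h1 := Finset.le_card_sdiff (G.nbrs B₂ W₁) (W₁ \ G.ballIn W₁ v₂ (k + 1))
    rw [← hW₂] at h1
    have h2 := Finset.le_card_sdiff (G.ballIn W₁ v₂ (k + 1)) W₁
    have h3 := hball' W₁ hW₁S v₂ hv₂
    omega
  -- the third linked set
  obtain ⟨v₃, hv₃, B₃, hB₃, hB₃c, hB₃cov⟩ := hcost₃.2 W₂ hW₂S (by omega)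
  have hKB₃ : G.ballIn W₂ v₃ k ∪ B₃ ⊆ W₂ := Finset.union_subset (ballIn_subset hv₃ k)
    (hB₃.trans (ballIn_subset hv₃ _))
  have hcheap : ∀ C ⊆ S, ∀ B' ⊆ B₃, B'.card ≤ 2 * t ^ j → (G.nbrs B' C).card ≤ 10 ^ 3 * κ := by
    intro C hC B' hB' hB'c
    have h1 : 0 < t ^ j := Nat.pow_pos ht
    have h2 := hcost₃.1 v₃ (hW₂S hv₃) B'
      (hB'.trans (hB₃.trans (ballIn_mono_set hW₂S v₃ _))) (by omega)
    exact (Finset.card_le_card (nbrs_mono subset_rfl hC)).trans h2.le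
  have hB₃s : B₃.card ≤ 3 * t * t ^ j := by rw [pow_succ] at hB₃c; linarith
  -- `B₃` is thinned twice, against the neighbours of `T₁` and then of `T₂`. It needs no trimming,
  -- as no further set is built outside its neighbourhood.
  obtain ⟨D₃, hD₃, E₁, hE₁, hE₁c, hD₃cov, hpriv₁₃⟩ := h.exists_private hQ
    (T := T₁) (C := C₁') (K := G.ballIn W₂ v₃ k) (B := B₃) (W := W₂) (κ := 2 * κ)
    (lam := 10 ^ 3 * κ) (s := t ^ j) (t := t) hT₁l (fun c hc => hC₁a c (hC₁' hc))
    (isLinked_ballIn W₂ v₃ k)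
    ⟨v₃, mem_ballIn_self W₂ v₃ k⟩ (fun b hb => attached_of_mem_ballIn_succ (hB₃ hb))
    (fun x hx => hW₁d x (hW₂W (hKB₃ hx))) (fun w hw => hW₁d w (hW₂W hw))
    ((hcore W₂ hW₂S v₃ hv₃ C₁' (hC₁'.trans hC₁S)).trans (by omega))
    (hcore' W₂ hW₂S v₃ hv₃ W₂ hW₂S)
    (hcheap C₁' (hC₁'.trans hC₁S)) (Nat.pow_pos ht) hB₃s (by omega) (by omega)
  obtain ⟨F₃, hF₃, E₂, hE₂, hE₂c, hF₃cov, hpriv₂₃⟩ := h.exists_private hQ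
    (T := T₂) (C := C₂) (K := G.ballIn W₂ v₃ k) (B := D₃) (W := W₂) (κ := 2 * κ)
    (lam := 10 ^ 3 * κ) (s := t ^ j) (t := t) hT₂l hC₂a (isLinked_ballIn W₂ v₃ k)
    ⟨v₃, mem_ballIn_self W₂ v₃ k⟩ (fun b hb => attached_of_mem_ballIn_succ (hB₃ (hD₃ hb)))
    (fun x hx => hW₂d x (hKB₃ (Finset.union_subset_union subset_rfl hD₃ hx))) hW₂d
    ((hcore W₂ hW₂S v₃ hv₃ C₂ hC₂S).trans (by omega))
    (hcore' W₂ hW₂S v₃ hv₃ W₂ hW₂S)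
    (fun B' hB' => hcheap C₂ hC₂S B' (hB'.trans hD₃)) (Nat.pow_pos ht)
    ((Finset.card_le_card hD₃).trans hB₃s) (by omega) (by omega)
  have hF₃b := hF₃.trans (hD₃.trans hB₃)
  set T₃ := G.ballIn W₂ v₃ k ∪ F₃ with hT₃
  have hT₃W : T₃ ⊆ W₂ :=
    (Finset.union_subset_union subset_rfl (hF₃.trans hD₃)).trans hKB₃
  set C₃ := G.nbrs F₃ W₂ \ G.ballIn W₂ v₃ (k + 1) with hC₃
  have hC₃c : (G.nbrs F₃ W₂).card ≤ C₃.card + κ := by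
    have h1 := Finset.le_card_sdiff (G.ballIn W₂ v₃ (k + 1)) (G.nbrs F₃ W₂)
    rw [← hC₃] at h1
    have h2 := hball' W₂ hW₂S v₃ hv₃
    omega
  have hC₃W : C₃ ⊆ W₂ := Finset.sdiff_subset.trans nbrs_subset
  refine h.false_of_triple hQ (T₁ := T₁) (T₂ := T₂) (T₃ := T₃) (C₁ := E₁) (C₂ := E₂) (C₃ := C₃)
    hT₁l hT₂l (isLinked_ballIn_union hF₃b)
    (detached_comm fun x hx => hW₁d x (hT₂W hx))
    (detached_comm fun x hx => hW₁d x (hW₂W (hT₃W hx))) ?_ ?_ ?_ (by omega) (by omega) (by omega)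
  · intro c hc
    exact ⟨hC₁a c (hC₁' (hE₁ hc)), hpriv₁₂ c (hE₁ hc),
      (hpriv₁₃ c hc).mono (Finset.union_subset_union subset_rfl hF₃)⟩
  · intro c hc
    exact ⟨hC₂a c (hE₂ hc), hW₁d c (hC₂W (hE₂ hc)), hpriv₂₃ c hc⟩
  · intro c hc
    exact ⟨attached_ballIn_union hF₃b hc, hW₁d c (hW₂W (hC₃W hc)), hW₂d c (hC₃W hc)⟩

end Spread

/-! ### Sparse pairs, sparse families and Rödl's theorem without pentagons -/

/-- The number of pairs in `A × B` that are adjacent. -/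
noncomputable def edgeCount (G : SimpleGraph V) (A B : Finset V) : ℕ :=
  ∑ a ∈ A, (G.nbrs {a} B).card

theorem edgeCount_comm (A B : Finset V) : G.edgeCount A B = G.edgeCount B A := by
  classical
  have h : ∀ A B : Finset V, G.edgeCount A B = ∑ a ∈ A, ∑ b ∈ B, if G.Adj a b then 1 else 0 := by
    intro A B
    refine Finset.sum_congr rfl fun a _ => ?_
    rw [← Finset.card_filter]
    congr 1
    ext b
    simp
  rw [h, h, Finset.sum_comm]
  simp only [G.adj_comm]

theorem edgeCount_mono {A A' B B' : Finset V} (hA : A ⊆ A') (hB : B ⊆ B') :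
    G.edgeCount A B ≤ G.edgeCount A' B' :=
  (Finset.sum_le_sum fun _ _ => Finset.card_le_card (nbrs_mono subset_rfl hB)).trans
    (Finset.sum_le_sum_of_subset hA)

theorem edgeCount_le_mul (A B : Finset V) : G.edgeCount A B ≤ A.card * B.card := by
  rw [← smul_eq_mul]
  exact Finset.sum_le_card_nsmul _ _ _ fun a _ => Finset.card_le_card nbrs_subset

/-- A subset of prescribed size on which `f` has at most average sum. -/
theorem exists_subset_sum_le (f : V → ℕ) (B : Finset V) (w : ℕ) (hw : w ≤ B.card) :
    ∃ B' ⊆ B, B'.card = w ∧ B.card * ∑ b ∈ B', f b ≤ w * ∑ b ∈ B, f b := by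
  classical
  induction hn : B.card - w generalizing B with
  | zero =>
    have : B.card = w := by omega
    exact ⟨B, subset_rfl, this, by rw [this]⟩
  | succ n ih =>
    -- Deleting an element of largest value does not raise the average.
    obtain ⟨x, hx, hmax⟩ := Finset.exists_max_image B f (Finset.card_pos.1 (by omega))
    have hc := Finset.card_erase_of_mem hx
    obtain ⟨B', hB', hB'c, hsum⟩ := ih (B.erase x) (by omega) (by omega)
    refine ⟨B', hB'.trans (Finset.erase_subset _ _), hB'c, ?_⟩
    have h1 := Finset.add_sum_erase B f hx
    have h2 : ∑ b ∈ B, f b ≤ B.card * f x := by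
      rw [← smul_eq_mul]
      exact Finset.sum_le_card_nsmul _ _ _ hmax
    rcases Nat.eq_zero_or_pos (B.card - 1) with h0 | hpos
    · have : w = 0 := by omega
      subst this
      rw [Finset.card_eq_zero] at hB'c
      simp [hB'c]
    · rw [hc] at hsum
      refine le_of_mul_le_mul_left ?_ hpos
      obtain ⟨c, hc'⟩ : ∃ c, B.card = c + 1 := ⟨B.card - 1, by omega⟩
      rw [hc'] at h2 hsum ⊢
      simp only [Nat.add_sub_cancel] at hsum ⊢
      rw [← h1] at h2 ⊢
      have h3 : ∑ b ∈ B.erase x, f b ≤ c * f x := by linarith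
      have h4 := Nat.mul_le_mul_left w h3
      have h5 := Nat.mul_le_mul_left (c + 1) hsum
      linarith

theorem exists_parts (k u : ℕ) (X : Finset V) (h : k * u ≤ X.card) :
    ∃ S : ℕ → Finset V, (∀ i < k, S i ⊆ X ∧ (S i).card = u) ∧
      ∀ i j, i < j → j < k → Disjoint (S i) (S j) := by
  classical
  induction k generalizing X with
  | zero => exact ⟨fun _ => ∅, by simp, by simp⟩
  | succ k ih =>
    rw [Nat.add_mul, one_mul] at h
    obtain ⟨Y, hY, hYc⟩ := Finset.exists_subset_card_eq (show u ≤ X.card by omega)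
    obtain ⟨S, hS, hSd⟩ := ih (X \ Y) (by rw [Finset.card_sdiff_of_subset hY]; omega)
    refine ⟨fun i => if i < k then S i else Y, ?_, ?_⟩
    · intro i hi
      by_cases h : i < k
      · simpa [h] using ⟨(hS i h).1.trans Finset.sdiff_subset, (hS i h).2⟩
      · simpa [h] using ⟨hY, hYc⟩
    · intro i j hij hj
      have hi : i < k := by omega
      by_cases h : j < k
      · simpa [h, hi] using hSd i j hij h
      · simpa [h, hi] using Finset.disjoint_of_subset_left (hS i hi).1 Finset.sdiff_disjoint

/-- Either a prescribed pattern is embedded as an induced subgraph with one vertex in each part, or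
there are large sets `A`, `B` in different parts with few edges or few non-edges between them. -/
theorem exists_pattern_or_pair {ε : ℝ} (hε : 0 < ε) (hε1 : ε ≤ 1) (k : ℕ) :
    ∀ (p : ℕ → ℕ → Prop) (u : ℝ), 0 < u → ∀ S : ℕ → Finset V,
      (∀ i ≤ k, u ≤ (S i).card) → (∀ i j, i < j → j ≤ k → Disjoint (S i) (S j)) →
      (∃ h : ℕ → V, (∀ i ≤ k, h i ∈ S i) ∧
        ∀ i j, i < j → j ≤ k → (G.Adj (h i) (h j) ↔ p i j)) ∨
      (∃ i j, i < j ∧ j ≤ k ∧ ∃ A ⊆ S i, ∃ B ⊆ S j,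
        ε ^ k * u / (k + 1) ≤ A.card ∧ ε ^ k * u / (k + 1) ≤ B.card ∧
        ((∀ a ∈ A, ((G.nbrs {a} B).card : ℝ) ≤ ε * B.card) ∨
          ∀ a ∈ A, ((Gᶜ.nbrs {a} B).card : ℝ) ≤ ε * B.card)) := by
  classical
  induction k with
  | zero =>
    intro p u hu S hS _
    have : (S 0).Nonempty := by
      rw [← Finset.card_pos]
      exact_mod_cast hu.trans_le (hS 0 le_rfl)
    obtain ⟨v, hv⟩ := this
    refine Or.inl ⟨fun _ => v, ?_, ?_⟩
    · intro i hi
      obtain rfl : i = 0 := by omega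
      exact hv
    · intro i j hij hj
      omega
  | succ k ih =>
    intro p u hu S hS hdisj
    -- The candidates left in part j once `v` plays vertex 0 of the pattern.
    let R : V → ℕ → Finset V := fun v j =>
      if p 0 j then G.nbrs {v} (S j) else Gᶜ.nbrs {v} (S j)
    have hRS : ∀ v j, R v j ⊆ S j := by
      intro v j
      simp only [R]
      split_ifs <;> exact nbrs_subset
    have hpow : 0 < ε ^ k := pow_pos hε k
    have hpow1 : ε ^ k ≤ 1 := pow_le_one₀ hε.le hε1
    -- Either some `v` leaves an ε-fraction of every later part, and the recursion continues there,
    -- or every `v` fails for some part, and the most frequent such part gives the pair.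
    by_cases hex : ∃ v ∈ S 0, ∀ j, 1 ≤ j → j ≤ k + 1 → ε * (S j).card ≤ (R v j).card
    · obtain ⟨v, hv, hvR⟩ := hex
      have hbig : ∀ i ≤ k, ε * u ≤ (R v (i + 1)).card := fun i hi =>
        (mul_le_mul_of_nonneg_left (hS (i + 1) (by omega)) hε.le).trans
          (hvR (i + 1) (by omega) (by omega))
      rcases ih (fun i j => p (i + 1) (j + 1)) (ε * u) (by positivity) (fun i => R v (i + 1)) hbig
        (fun i j hij hj => Finset.disjoint_of_subset_left (hRS _ _)
          (Finset.disjoint_of_subset_right (hRS _ _) (hdisj _ _ (by omega) (by omega)))) with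
        ⟨h, hh, hadj⟩ | ⟨i, j, hij, hj, A, hA, B, hB, hAc, hBc, hAB⟩
      · left
        refine ⟨fun i => if i = 0 then v else h (i - 1), ?_, ?_⟩
        · intro i hi
          by_cases h0 : i = 0
          · simpa [h0] using hv
          · have := hRS _ _ (hh (i - 1) (by omega))
            rw [show i - 1 + 1 = i by omega] at this
            simpa [h0] using this
        · intro i j hij hj
          have hj0 : j ≠ 0 := by omega
          by_cases h0 : i = 0
          · subst h0
            have h1 := hh (j - 1) (by omega)
            rw [show j - 1 + 1 = j by omega] at h1
            have hne : v ≠ h (j - 1) := by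
              intro e
              exact Finset.disjoint_left.1 (hdisj 0 j hij hj) hv (e ▸ hRS _ _ h1)
            simp only [if_true, hj0, if_false]
            simp only [R] at h1
            split_ifs at h1 with hp
            · have := (mem_nbrs.1 h1).2
              simp only [Finset.mem_singleton, exists_eq_left] at this
              exact ⟨fun _ => hp, fun _ => this⟩
            · have := (mem_nbrs.1 h1).2
              simp only [Finset.mem_singleton, exists_eq_left, compl_adj] at this
              exact ⟨fun h => absurd h this.2, fun h => absurd h hp⟩
          · have := hadj (i - 1) (j - 1) (by omega) (by omega)
            rw [show i - 1 + 1 = i by omega, show j - 1 + 1 = j by omega] at this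
            simpa [h0, hj0] using this
      · right
        refine ⟨i + 1, j + 1, by omega, by omega, A, hA.trans (hRS _ _), B, hB.trans (hRS _ _),
          ?_, ?_, hAB⟩
        · refine le_trans ?_ hAc
          push_cast
          rw [pow_succ, mul_assoc]
          gcongr
          linarith
        · refine le_trans ?_ hBc
          push_cast
          rw [pow_succ, mul_assoc]
          gcongr
          linarith
    · right
      push Not at hex
      have hcover : S 0 ⊆ (Finset.range (k + 1)).biUnion (fun i =>
          (S 0).filter (fun v => ((R v (i + 1)).card : ℝ) < ε * (S (i + 1)).card)) := by
        intro v hv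
        obtain ⟨j, hj1, hj2, hlt⟩ := hex v hv
        refine Finset.mem_biUnion.2 ⟨j - 1, Finset.mem_range.2 (by omega),
          Finset.mem_filter.2 ⟨hv, ?_⟩⟩
        rwa [show j - 1 + 1 = j by omega]
      obtain ⟨i, hi, hic⟩ : ∃ i < k + 1, u / (k + 1) ≤
          ((S 0).filter (fun v => ((R v (i + 1)).card : ℝ) < ε * (S (i + 1)).card)).card := by
        by_contra! hno
        have h1 := (Finset.card_le_card hcover).trans Finset.card_biUnion_le
        have h2 : ((S 0).card : ℝ) ≤ ∑ i ∈ Finset.range (k + 1),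
            (((S 0).filter (fun v => ((R v (i + 1)).card : ℝ) < ε * (S (i + 1)).card)).card : ℝ) :=
          by exact_mod_cast h1
        have h3 := Finset.sum_lt_sum_of_nonempty (s := Finset.range (k + 1)) ⟨0, by simp⟩
          (fun i hi => hno i (Finset.mem_range.1 hi))
        rw [Finset.sum_const, Finset.card_range, nsmul_eq_mul] at h3
        have h4 : ((k + 1 : ℕ) : ℝ) * (u / (k + 1)) = u := by
          push_cast
          field_simp
        have h5 := hS 0 (by omega)
        linarith
      have hle : ε ^ (k + 1) * u / ((k + 1 : ℕ) + 1) ≤ u / (k + 1) := by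
        push_cast
        apply div_le_div₀ hu.le _ (by positivity) (by linarith)
        exact mul_le_of_le_one_left hu.le (pow_le_one₀ hε.le hε1)
      refine ⟨0, i + 1, by omega, by omega, _, Finset.filter_subset _ _, S (i + 1), subset_rfl,
        hle.trans hic, hle.trans ?_, ?_⟩
      · refine (div_le_self hu.le ?_).trans (hS _ (by omega))
        have : (0 : ℝ) ≤ k := Nat.cast_nonneg k
        linarith
      · by_cases hp : p 0 (i + 1)
        · left
          intro a ha
          have := (Finset.mem_filter.1 ha).2
          simp only [R, hp, if_true] at this
          exact this.le
        · right
          intro a ha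
          have := (Finset.mem_filter.1 ha).2
          simp only [R, hp, if_false] at this
          exact this.le

/-- `S 0, …, S (k - 1)` are disjoint subsets of `X` of size `w` with few edges between them. -/
def SparseFamily (G : SimpleGraph V) (X : Finset V) (k w : ℕ) (ε : ℝ) (S : ℕ → Finset V) : Prop :=
  (∀ i < k, S i ⊆ X ∧ (S i).card = w) ∧
  ∀ i j, i < j → j < k → Disjoint (S i) (S j) ∧ (G.edgeCount (S i) (S j) : ℝ) ≤ ε * w ^ 2

/-- The degree bound survives any choice of `A'`; `B'` is then chosen with at most average degree
into `A'`. -/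
theorem exists_sparse_trim {A B : Finset V} {w : ℕ} {ε : ℝ} (hwA : w ≤ A.card)
    (hwB : w ≤ B.card) (h : ∀ a ∈ A, ((G.nbrs {a} B).card : ℝ) ≤ ε * B.card) :
    ∃ A' ⊆ A, ∃ B' ⊆ B, A'.card = w ∧ B'.card = w ∧ (G.edgeCount A' B' : ℝ) ≤ ε * w ^ 2 := by
  obtain ⟨A', hA', hA'c⟩ := Finset.exists_subset_card_eq hwA
  obtain ⟨B', hB', hB'c, hsum⟩ := exists_subset_sum_le (fun b => (G.nbrs {b} A').card) B w hwB
  refine ⟨A', hA', B', hB', hA'c, hB'c, ?_⟩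
  change B.card * G.edgeCount B' A' ≤ w * G.edgeCount B A' at hsum
  rw [edgeCount_comm B', edgeCount_comm B] at hsum
  have h1 : (G.edgeCount A' B : ℝ) ≤ w * (ε * B.card) := by
    rw [edgeCount, Nat.cast_sum, ← hA'c, ← nsmul_eq_mul]
    exact Finset.sum_le_card_nsmul _ _ _ fun a ha => h a (hA' ha)
  have h2 : (B.card : ℝ) * G.edgeCount A' B' ≤ w * G.edgeCount A' B := by exact_mod_cast hsum
  rcases Nat.eq_zero_or_pos B.card with h0 | hpos
  · have hw0 : w = 0 := by omega
    subst hw0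
    rw [Finset.card_eq_zero] at hA'c
    simp [hA'c, edgeCount]
  · have hB0 : (0 : ℝ) < B.card := by exact_mod_cast hpos
    refine le_of_mul_le_mul_left ?_ hB0
    have h3 := mul_le_mul_of_nonneg_left h1 (Nat.cast_nonneg (α := ℝ) w)
    nlinarith

/-- In graphs without pentagons, every large set contains two disjoint large sets of equal size
with few edges or few non-edges between them. -/
theorem exists_sparse_pair {ε : ℝ} (hε : 0 < ε) (hε1 : ε ≤ 1) :
    ∃ σ : ℝ, 0 < σ ∧ σ ≤ 1 ∧ ∀ (V : Type u) (G : SimpleGraph V), G.CliqueIndepBound →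
      ∀ X : Finset V, 10 ≤ X.card → ∃ A ⊆ X, ∃ B ⊆ X, Disjoint A B ∧ A.card = B.card ∧
        σ * X.card ≤ A.card ∧
        ((G.edgeCount A B : ℝ) ≤ ε * A.card ^ 2 ∨ (Gᶜ.edgeCount A B : ℝ) ≤ ε * A.card ^ 2) := by
  have hpow : 0 < ε ^ 4 := pow_pos hε 4
  have hpow1 : ε ^ 4 ≤ 1 := pow_le_one₀ hε.le hε1
  -- Five parts of size at least |X|/10 lose a factor ε^4/5. The pattern is the pentagon, which
  -- `not_isHole` excludes.
  refine ⟨ε ^ 4 / 50, by positivity, by linarith, ?_⟩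
  intro V G hG X hX
  obtain ⟨S, hS, hdisj⟩ := exists_parts 5 (X.card / 5) X (Nat.mul_div_le _ _)
  have hu : (X.card : ℝ) / 10 ≤ (X.card / 5 : ℕ) := by
    have h1 : X.card ≤ 10 * (X.card / 5) := by omega
    have h2 : (X.card : ℝ) ≤ 10 * (X.card / 5 : ℕ) := by exact_mod_cast h1
    linarith
  have hX0 : (0 : ℝ) < X.card := by
    have : 0 < X.card := by omega
    exact_mod_cast this
  rcases exists_pattern_or_pair (G := G) hε hε1 4
    (fun i j => j = i + 1 ∨ (i = 0 ∧ j + 1 = 5)) (X.card / 10) (by positivity) S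
    (fun i hi => by rw [(hS i (by omega)).2]; exact hu)
    (fun i j hij hj => hdisj i j hij (by omega)) with
    ⟨h, hh, hadj⟩ | ⟨i, j, hij, hj, A, hA, B, hB, hAc, hBc, hAB⟩
  · exfalso
    refine hG.not_isHole (k := 2) le_rfl (h := h) ?_
    intro i j hij hj
    refine ⟨fun e => ?_, hadj i j hij (by omega)⟩
    exact Finset.disjoint_left.1 (hdisj i j hij (by omega)) (hh i (by omega))
      (e ▸ hh j (by omega))
  · have hAX := hA.trans (hS i (by omega)).1
    have hBX := hB.trans (hS j (by omega)).1
    have hAB' : Disjoint A B := Finset.disjoint_of_subset_left hA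
      (Finset.disjoint_of_subset_right hB (hdisj i j hij (by omega)))
    have he : ε ^ 4 * ((X.card : ℝ) / 10) / ((4 : ℕ) + 1) = ε ^ 4 / 50 * X.card := by
      push_cast
      ring
    rw [he] at hAc hBc
    have hwA : ⌈ε ^ 4 / 50 * X.card⌉₊ ≤ A.card := Nat.ceil_le.2 hAc
    have hwB : ⌈ε ^ 4 / 50 * X.card⌉₊ ≤ B.card := Nat.ceil_le.2 hBc
    have hfin : ∀ A' ⊆ A, ∀ B' ⊆ B, A' ⊆ X ∧ B' ⊆ X ∧ Disjoint A' B' := fun A' hA' B' hB' =>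
      ⟨hA'.trans hAX, hB'.trans hBX, Finset.disjoint_of_subset_left hA'
        (Finset.disjoint_of_subset_right hB' hAB')⟩
    rcases hAB with hAB | hAB
    · obtain ⟨A', hA', B', hB', hA'c, hB'c, hcount⟩ := exists_sparse_trim hwA hwB hAB
      obtain ⟨h1, h2, h3⟩ := hfin A' hA' B' hB'
      refine ⟨A', h1, B', h2, h3, hA'c.trans hB'c.symm, ?_, Or.inl (by rwa [hA'c])⟩
      rw [hA'c]
      exact Nat.le_ceil _
    · obtain ⟨A', hA', B', hB', hA'c, hB'c, hcount⟩ := exists_sparse_trim hwA hwB hAB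
      obtain ⟨h1, h2, h3⟩ := hfin A' hA' B' hB'
      refine ⟨A', h1, B', h2, h3, hA'c.trans hB'c.symm, ?_, Or.inr (by rwa [hA'c])⟩
      rw [hA'c]
      exact Nat.le_ceil _

theorem SparseFamily.mono {X Y : Finset V} {k w : ℕ} {ε : ℝ} {S : ℕ → Finset V}
    (h : G.SparseFamily X k w ε S) (hXY : X ⊆ Y) : G.SparseFamily Y k w ε S :=
  ⟨fun i hi => ⟨(h.1 i hi).1.trans hXY, (h.1 i hi).2⟩, h.2⟩

/-- A sparse family inside one side of a sparse pair extends by a subset of the other side. -/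
theorem SparseFamily.extend {A B X : Finset V} {s w : ℕ} {ε ε' σ : ℝ} {S : ℕ → Finset V}
    (h : G.SparseFamily A (s + 1) w ε S) (hAX : A ⊆ X) (hBX : B ⊆ X) (hAB : Disjoint A B)
    (hc : A.card = B.card) (hσ : 0 ≤ σ) (hw : σ * A.card ≤ w) (hε : 0 ≤ ε) (hε' : ε' ≤ ε * σ ^ 2)
    (hcount : (G.edgeCount A B : ℝ) ≤ ε' * A.card ^ 2) :
    ∃ S', G.SparseFamily X (s + 2) w ε S' := by
  have hwA : w ≤ A.card := by
    rw [← (h.1 0 (by omega)).2]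
    exact Finset.card_le_card (h.1 0 (by omega)).1
  obtain ⟨B', hB', hB'c⟩ := Finset.exists_subset_card_eq (hc ▸ hwA)
  refine ⟨fun i => if i < s + 1 then S i else B', ?_, ?_⟩
  · intro i hi
    by_cases hi' : i < s + 1
    · simpa [hi'] using ⟨(h.1 i hi').1.trans hAX, (h.1 i hi').2⟩
    · simpa [hi'] using ⟨hB'.trans hBX, hB'c⟩
  · intro i j hij hj
    have hi' : i < s + 1 := by omega
    by_cases hj' : j < s + 1
    · simpa [hi', hj'] using h.2 i j hij hj'
    · simp only [hi', hj', if_true, if_false]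
      have hSA := (h.1 i hi').1
      refine ⟨Finset.disjoint_of_subset_left hSA (Finset.disjoint_of_subset_right hB' hAB), ?_⟩
      have h1 : (G.edgeCount (S i) B' : ℝ) ≤ G.edgeCount A B := by
        exact_mod_cast edgeCount_mono hSA hB'
      -- As w ≥ σ|A|, the count ε'|A|² is at most εw², so any w-subset of `B` can serve as the new
      -- member.
      have h2 : (σ * A.card) ^ 2 ≤ (w : ℝ) ^ 2 := pow_le_pow_left₀ (by positivity) hw 2
      calc (G.edgeCount (S i) B' : ℝ) ≤ ε' * A.card ^ 2 := h1.trans hcount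
        _ ≤ ε * σ ^ 2 * A.card ^ 2 := by gcongr
        _ = ε * (σ * A.card) ^ 2 := by ring
        _ ≤ ε * w ^ 2 := by gcongr

theorem sparseFamily_one (X : Finset V) (ε : ℝ) : G.SparseFamily X 1 X.card ε (fun _ => X) :=
  ⟨fun _ _ => ⟨subset_rfl, rfl⟩, fun i j hij hj => by omega⟩

/-- Large sets contain many large subsets that are pairwise sparse, or pairwise sparse in the
complement. -/
theorem exists_sparseFamily {ε : ℝ} (hε : 0 < ε) (n : ℕ) : ∀ s t : ℕ, s + t ≤ n →
    ∃ σ : ℝ, 0 < σ ∧ σ ≤ 1 ∧ ∃ N : ℕ, ∀ (V : Type u) (G : SimpleGraph V), G.CliqueIndepBound →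
      ∀ X : Finset V, N ≤ X.card → ∃ w : ℕ, σ * X.card ≤ w ∧
        ((∃ S, G.SparseFamily X (s + 1) w ε S) ∨ ∃ S, Gᶜ.SparseFamily X (t + 1) w ε S) := by
  induction n with
  | zero =>
    intro s t hst
    obtain rfl : s = 0 := by omega
    exact ⟨1, one_pos, le_rfl, 0, fun V G _ X _ =>
      ⟨X.card, by simp, Or.inl ⟨_, sparseFamily_one X ε⟩⟩⟩
  | succ n ih =>
    intro s t hst
    rcases Nat.eq_zero_or_pos s with rfl | hs
    · exact ⟨1, one_pos, le_rfl, 0, fun V G _ X _ =>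
        ⟨X.card, by simp, Or.inl ⟨_, sparseFamily_one X ε⟩⟩⟩
    rcases Nat.eq_zero_or_pos t with rfl | ht
    · exact ⟨1, one_pos, le_rfl, 0, fun V G _ X _ =>
        ⟨X.card, by simp, Or.inr ⟨_, sparseFamily_one X ε⟩⟩⟩
    obtain ⟨s, rfl⟩ : ∃ s', s = s' + 1 := ⟨s - 1, by omega⟩
    obtain ⟨t, rfl⟩ : ∃ t', t = t' + 1 := ⟨t - 1, by omega⟩
    -- As in Ramsey's theorem: a sparse pair lengthens a sparse family found inside `A`, and a
    -- co-sparse pair lengthens a family of the complement.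
    obtain ⟨σ₁, hσ₁, hσ₁1, N₁, h₁⟩ := ih s (t + 1) (by omega)
    obtain ⟨σ₂, hσ₂, hσ₂1, N₂, h₂⟩ := ih (s + 1) t (by omega)
    set σ := min σ₁ σ₂ with hσ
    have hσ0 : 0 < σ := lt_min hσ₁ hσ₂
    obtain ⟨σ₀, hσ₀, hσ₀1, h₀⟩ := exists_sparse_pair.{u} (ε := min 1 (ε * σ ^ 2))
      (by positivity) (min_le_left _ _)
    refine ⟨σ * σ₀, by positivity, ?_, max 10 ⌈(max N₁ N₂ : ℝ) / σ₀⌉₊, ?_⟩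
    · exact mul_le_one₀ ((min_le_left _ _).trans hσ₁1) hσ₀.le hσ₀1
    intro V G hG X hX
    obtain ⟨A, hA, B, hB, hAB, hABc, hAc, hcount⟩ := h₀ V G hG X ((le_max_left _ _).trans hX)
    have hXr : (max N₁ N₂ : ℝ) ≤ σ₀ * X.card := by
      have h1 := Nat.ceil_le.1 ((le_max_right _ _).trans hX)
      rw [div_le_iff₀ hσ₀] at h1
      linarith
    have hAN : (max N₁ N₂ : ℝ) ≤ A.card := hXr.trans hAc
    have hAN₁ : N₁ ≤ A.card := by exact_mod_cast (le_max_left _ _).trans hAN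
    have hAN₂ : N₂ ≤ A.card := by exact_mod_cast (le_max_right _ _).trans hAN
    have hsize : ∀ σ' w : ℝ, σ ≤ σ' → σ' * A.card ≤ w → σ * σ₀ * X.card ≤ w := by
      intro σ' w h1 h2
      calc σ * σ₀ * X.card = σ * (σ₀ * X.card) := by ring
        _ ≤ σ * A.card := by gcongr
        _ ≤ σ' * A.card := by gcongr
        _ ≤ w := h2
    have hεσ : ∀ σ', σ ≤ σ' → min 1 (ε * σ ^ 2) ≤ ε * σ' ^ 2 := by
      intro σ' h1
      refine (min_le_right _ _).trans ?_
      gcongr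
    rcases hcount with hcount | hcount
    · obtain ⟨w, hw, ⟨S, hS⟩ | ⟨S, hS⟩⟩ := h₁ V G hG A hAN₁
      · exact ⟨w, hsize σ₁ w (min_le_left _ _) hw, Or.inl (hS.extend hA hB hAB hABc hσ₁.le hw hε.le
          (hεσ σ₁ (min_le_left _ _)) hcount)⟩
      · exact ⟨w, hsize σ₁ w (min_le_left _ _) hw, Or.inr ⟨S, hS.mono hA⟩⟩
    · obtain ⟨w, hw, ⟨S, hS⟩ | ⟨S, hS⟩⟩ := h₂ V G hG A hAN₂
      · exact ⟨w, hsize σ₂ w (min_le_right _ _) hw, Or.inl ⟨S, hS.mono hA⟩⟩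
      · exact ⟨w, hsize σ₂ w (min_le_right _ _) hw, Or.inr (hS.extend hA hB hAB hABc hσ₂.le hw
          hε.le (hεσ σ₂ (min_le_right _ _)) hcount)⟩

/-- The union of a long sparse family contains a large set inducing small degrees. -/
theorem SparseFamily.exists_small_degree {X : Finset V} {k w : ℕ} {δ : ℝ} {S : ℕ → Finset V}
    (hδ : 0 < δ) (hk : 8 ≤ δ * k) (h : G.SparseFamily X k w (δ / 8) S) :
    ∃ Y : Finset V, w ≤ 2 * Y.card ∧ ∀ v ∈ Y, ((G.nbrs {v} Y).card : ℝ) ≤ δ * Y.card := by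
  classical
  have hk0 : 1 ≤ k := by
    rcases Nat.eq_zero_or_pos k with rfl | h0
    · norm_num at hk
    · exact h0
  set U := (Finset.range k).biUnion S with hU
  have hdis : ∀ i ∈ Finset.range k, ∀ j ∈ Finset.range k, i ≠ j → Disjoint (S i) (S j) := by
    intro i hi j hj hij
    rw [Finset.mem_range] at hi hj
    rcases Nat.lt_or_gt_of_ne hij with h1 | h1
    · exact (h.2 i j h1 hj).1
    · exact (h.2 j i h1 hi).1.symm
  have hUc : U.card = k * w := by
    rw [hU, Finset.card_biUnion hdis, Finset.sum_congr rfl fun i hi =>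
      (h.1 i (Finset.mem_range.1 hi)).2]
    simp
  -- Diagonal pairs are bounded trivially; their total kw² is at most (δ/8)(kw)², since δk ≥ 8.
  have hcount : ∀ i ∈ Finset.range k, ∀ j ∈ Finset.range k,
      (G.edgeCount (S i) (S j) : ℝ) ≤ δ / 8 * w ^ 2 + if i = j then (w : ℝ) ^ 2 else 0 := by
    intro i hi j hj
    rw [Finset.mem_range] at hi hj
    have hw2 : 0 ≤ δ / 8 * (w : ℝ) ^ 2 := by positivity
    rcases lt_trichotomy i j with h1 | h1 | h1
    · simpa [h1.ne] using (h.2 i j h1 hj).2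
    · have h2 := edgeCount_le_mul (G := G) (S i) (S j)
      rw [(h.1 i hi).2, (h.1 j hj).2] at h2
      have h3 : (G.edgeCount (S i) (S j) : ℝ) ≤ w * w := by exact_mod_cast h2
      simp only [h1, if_true] at h3 ⊢
      nlinarith
    · rw [edgeCount_comm]
      simpa [h1.ne'] using (h.2 j i h1 hi).2
  have hnb : ∀ v, (G.nbrs {v} U).card ≤ ∑ j ∈ Finset.range k, (G.nbrs {v} (S j)).card := by
    intro v
    refine (Finset.card_le_card ?_).trans Finset.card_biUnion_le
    intro x hx
    obtain ⟨hx1, hx2⟩ := mem_nbrs.1 hx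
    obtain ⟨j, hj, hxj⟩ := Finset.mem_biUnion.1 hx1
    exact Finset.mem_biUnion.2 ⟨j, hj, mem_nbrs.2 ⟨hxj, hx2⟩⟩
  have hsum : (∑ v ∈ U, ((G.nbrs {v} U).card : ℝ)) ≤ δ / 4 * (U.card : ℝ) ^ 2 := by
    have h1 : (∑ v ∈ U, (G.nbrs {v} U).card) ≤
        ∑ i ∈ Finset.range k, ∑ j ∈ Finset.range k, G.edgeCount (S i) (S j) := by
      rw [hU, Finset.sum_biUnion hdis, ← hU]
      refine Finset.sum_le_sum fun i _ => ?_
      simp only [edgeCount]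
      rw [Finset.sum_comm]
      exact Finset.sum_le_sum fun v _ => hnb v
    have h2 : (∑ v ∈ U, ((G.nbrs {v} U).card : ℝ)) ≤
        ∑ i ∈ Finset.range k, ∑ j ∈ Finset.range k, (G.edgeCount (S i) (S j) : ℝ) := by
      exact_mod_cast h1
    have h3 := h2.trans (Finset.sum_le_sum fun i hi => Finset.sum_le_sum fun j hj =>
      hcount i hi j hj)
    have h4 : ∑ i ∈ Finset.range k, ∑ j ∈ Finset.range k,
        (δ / 8 * (w : ℝ) ^ 2 + if i = j then (w : ℝ) ^ 2 else 0) =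
        k * (k * (δ / 8 * (w : ℝ) ^ 2)) + k * (w : ℝ) ^ 2 := by
      simp only [Finset.sum_add_distrib, Finset.sum_const, Finset.card_range, nsmul_eq_mul,
        Finset.sum_ite_eq]
      congr 1
      rw [Finset.sum_congr rfl fun i hi => if_pos hi]
      simp
    rw [h4] at h3
    refine h3.trans ?_
    rw [hUc]
    push_cast
    have h5 : (8 : ℝ) * (k * (w : ℝ) ^ 2) ≤ δ * k * (k * (w : ℝ) ^ 2) :=
      mul_le_mul_of_nonneg_right hk (by positivity)
    nlinarith
  -- The average degree in `U` is at most δ|U|/4, so at least half of the vertices have degree at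
  -- most δ|U|/2 ≤ δ|Y|.
  set Y := U.filter (fun v => ((G.nbrs {v} U).card : ℝ) ≤ δ / 2 * U.card) with hY
  set Z := U.filter (fun v => ¬ ((G.nbrs {v} U).card : ℝ) ≤ δ / 2 * U.card) with hZ
  have hYZ : Y.card + Z.card = U.card := Finset.card_filter_add_card_filter_not _
  have hZle : (Z.card : ℝ) * (δ / 2 * U.card) ≤ δ / 4 * (U.card : ℝ) ^ 2 := by
    refine le_trans ?_ hsum
    rw [← nsmul_eq_mul]
    refine (Finset.card_nsmul_le_sum Z _ _ fun v hv => ?_).trans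
      (Finset.sum_le_sum_of_subset_of_nonneg (Finset.filter_subset _ _) fun _ _ _ =>
        Nat.cast_nonneg _)
    exact (not_le.1 (Finset.mem_filter.1 hv).2).le
  have hYU : U.card ≤ 2 * Y.card := by
    rcases Nat.eq_zero_or_pos U.card with h0 | hpos
    · omega
    · have hU0 : (0 : ℝ) < U.card := by exact_mod_cast hpos
      have h1 : (Z.card : ℝ) ≤ U.card / 2 := by
        have h2 : (δ / 2 * U.card) * (Z.card : ℝ) ≤ (δ / 2 * U.card) * (U.card / 2) := by
          nlinarith
        exact le_of_mul_le_mul_left h2 (by positivity)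
      have h2 : (Y.card : ℝ) + Z.card = U.card := by exact_mod_cast hYZ
      have h3 : (U.card : ℝ) ≤ 2 * Y.card := by linarith
      exact_mod_cast h3
  refine ⟨Y, ?_, ?_⟩
  · have := Nat.mul_le_mul_right w hk0
    omega
  · intro v hv
    have h1 := (Finset.mem_filter.1 hv).2
    have h2 : ((G.nbrs {v} Y).card : ℝ) ≤ (G.nbrs {v} U).card := by
      exact_mod_cast Finset.card_le_card (nbrs_mono subset_rfl (Finset.filter_subset _ _))
    have h3 : (U.card : ℝ) ≤ 2 * Y.card := by exact_mod_cast hYU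
    nlinarith

/-- Rödl's theorem for graphs without pentagons. -/
theorem exists_small_degree {δ : ℝ} (hδ : 0 < δ) :
    ∃ σ : ℝ, 0 < σ ∧ σ ≤ 1 ∧ ∃ N : ℕ, ∀ (V : Type u) [Fintype V] (G : SimpleGraph V),
      G.CliqueIndepBound → N ≤ Fintype.card V → ∃ Y : Finset V,
        σ * Fintype.card V ≤ Y.card ∧
        ((∀ v ∈ Y, ((G.nbrs {v} Y).card : ℝ) ≤ δ * Y.card) ∨
          ∀ v ∈ Y, ((Gᶜ.nbrs {v} Y).card : ℝ) ≤ δ * Y.card) := by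
  obtain ⟨k, hk⟩ := exists_nat_ge (8 / δ)
  have hk' : 8 ≤ δ * (k + 1 : ℕ) := by
    rw [div_le_iff₀ hδ] at hk
    push_cast
    nlinarith
  obtain ⟨σ, hσ, hσ1, N, hN⟩ := exists_sparseFamily.{u} (ε := δ / 8) (by positivity) (k + k) k k
    le_rfl
  refine ⟨σ / 2, by positivity, by linarith, N, fun V _ G hG hV => ?_⟩
  obtain ⟨w, hw, hor⟩ := hN V G hG Finset.univ (by simpa using hV)
  rw [Finset.card_univ] at hw
  have hfin : ∀ Y : Finset V, w ≤ 2 * Y.card → σ / 2 * Fintype.card V ≤ Y.card := by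
    intro Y hY
    have : (w : ℝ) ≤ 2 * Y.card := by exact_mod_cast hY
    linarith
  rcases hor with ⟨S, hS⟩ | ⟨S, hS⟩
  · obtain ⟨Y, hY, hdeg⟩ := hS.exists_small_degree hδ hk'
    exact ⟨Y, hfin Y hY, Or.inl hdeg⟩
  · obtain ⟨Y, hY, hdeg⟩ := hS.exists_small_degree hδ hk'
    exact ⟨Y, hfin Y hY, Or.inr hdeg⟩

/-! ### Choice of parameters and conclusion -/

/-- Sparse graphs without odd holes and odd antiholes have large anticomplete pairs. -/
theorem exists_anticomplete_pair {c : ℝ} (hc : 0 < c) (hc1 : c < 1) :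
    ∃ δ : ℝ, 0 < δ ∧ ∃ N : ℕ, ∀ (V : Type u) [Fintype V] (G : SimpleGraph V),
      G.CliqueIndepBound → N ≤ Fintype.card V →
      (∀ v, ((G.nbrs {v} Finset.univ).card : ℝ) ≤ δ * Fintype.card V) →
      ∃ A B : Finset V, Disjoint A B ∧ (∀ a ∈ A, ∀ b ∈ B, ¬ G.Adj a b) ∧
        δ * Fintype.card V ≤ A.card ∧ δ * (Fintype.card V : ℝ) ^ (1 - c) ≤ B.card := by
  -- With t ≥ n^(c/4) this gives t^q ≥ n² > n, while q depends only on c.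
  obtain ⟨q, hq⟩ := exists_nat_ge (8 / c)
  have hqc : 8 ≤ c * q := by
    rw [div_le_iff₀ hc] at hq
    linarith
  have hq1 : 1 ≤ q := by
    rcases Nat.eq_zero_or_pos q with rfl | h
    · norm_num at hqc
    · exact h
  obtain ⟨X, hX⟩ : ∃ X : ℕ, 10 ^ 8 ≤ X := ⟨_, le_rfl⟩
  set F : ℕ := 2 * X ^ (2 ^ q) with hF
  set M : ℕ := 2 ^ q * ((q + 1) * (q + 1) * F) + (q + 1) * (F + 4) with hM
  have hM0 : (0 : ℝ) < M := by
    have : 0 < M := by positivity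
    exact_mod_cast this
  -- Rounding up at most doubles δn, so d ≤ 2δn and dM ≤ n, which is the size condition of
  -- `false_of_large`.
  set δ : ℝ := 1 / (2 * M) with hδ
  have hδ0 : 0 < δ := by positivity
  have hlim : ∀ {y : ℝ}, 0 < y → ∀ C : ℝ, ∀ᶠ n : ℕ in Filter.atTop, C ≤ (n : ℝ) ^ y :=
    fun hy C => ((tendsto_rpow_atTop hy).comp tendsto_natCast_atTop_atTop).eventually
      (Filter.eventually_ge_atTop C)
  obtain ⟨N, hN⟩ := Filter.eventually_atTop.1 (((hlim (sub_pos.2 hc1) (1 / δ)).and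
    (hlim (show 0 < c / 4 by positivity) 2)).and (hlim (show 0 < c / 2 by positivity) 12))
  refine ⟨δ, hδ0, max N 2, ?_⟩
  intro V _ G hG hV hdeg
  obtain ⟨⟨h1, h2⟩, h3⟩ := hN (Fintype.card V) ((le_max_left _ _).trans hV)
  have hn2 : 2 ≤ Fintype.card V := (le_max_right _ _).trans hV
  set n := Fintype.card V with hn
  have hn1 : (1 : ℝ) < n := by exact_mod_cast hn2
  have hn0 : (0 : ℝ) < n := by linarith
  by_contra! hcon
  have hle : (n : ℝ) ^ (1 - c) ≤ n := by
    conv_rhs => rw [← Real.rpow_one (n : ℝ)]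
    exact Real.rpow_le_rpow_of_exponent_le hn1.le (by linarith)
  have hδ1 : 1 ≤ δ * (n : ℝ) ^ (1 - c) := by
    rwa [div_le_iff₀ hδ0, mul_comm] at h1
  have hδn : 1 ≤ δ * n := hδ1.trans (by gcongr)
  set d := ⌈δ * n⌉₊ with hd
  set m := ⌈δ * (n : ℝ) ^ (1 - c)⌉₊ with hm
  have hspread : G.Spread d m := by
    refine ⟨fun v S => ?_, fun A B hAB hA hB => ?_, ?_, ?_⟩
    · have h4 : (G.nbrs {v} S).card ≤ (G.nbrs {v} Finset.univ).card :=
        Finset.card_le_card (nbrs_mono subset_rfl (Finset.subset_univ _))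
      have h5 := (hdeg v).trans (Nat.le_ceil _)
      exact h4.trans (by exact_mod_cast h5)
    · by_contra! hno
      exact absurd (Nat.ceil_le.1 hB) (not_le.2 (hcon A B hAB hno (Nat.ceil_le.1 hA)))
    · exact Nat.ceil_pos.2 (by linarith)
    · exact Nat.ceil_le_ceil (by gcongr)
  have hd2 : (d : ℝ) ≤ 2 * (δ * n) := by
    have := Nat.ceil_lt_add_one (show 0 ≤ δ * (n : ℝ) by positivity)
    linarith
  have hm2 : (m : ℝ) ≤ 2 * (δ * (n : ℝ) ^ (1 - c)) := by
    have := Nat.ceil_lt_add_one (show 0 ≤ δ * (n : ℝ) ^ (1 - c) by positivity)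
    linarith
  -- The ratio of δn to δn^(1-c) is n^c; t uses half of this exponent, and the other half absorbs
  -- the constant 12.
  set t := ⌊(n : ℝ) ^ (c / 2)⌋₊ with ht
  have htle : (t : ℝ) ≤ (n : ℝ) ^ (c / 2) := Nat.floor_le (by positivity)
  have htge : (n : ℝ) ^ (c / 4) ≤ t := by
    have h4 := Nat.lt_floor_add_one ((n : ℝ) ^ (c / 2))
    have h5 : (n : ℝ) ^ (c / 2) = (n : ℝ) ^ (c / 4) * (n : ℝ) ^ (c / 4) := by
      rw [← Real.rpow_add hn0]
      congr 1
      ring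
    rw [h5] at h4
    rw [ht, h5]
    nlinarith
  have ht1 : 1 ≤ t := by
    have : (1 : ℝ) ≤ t := by linarith
    exact_mod_cast this
  have htm : 6 * t * m ≤ d := by
    have h4 : (6 * t * m : ℝ) ≤ δ * n := by
      have h5 : (n : ℝ) = (n : ℝ) ^ (c / 2) * ((n : ℝ) ^ (c / 2) * (n : ℝ) ^ (1 - c)) := by
        rw [← Real.rpow_add hn0, ← Real.rpow_add hn0]
        conv_lhs => rw [← Real.rpow_one (n : ℝ)]
        congr 1
        ring
      calc (6 * t * m : ℝ) ≤ 6 * (n : ℝ) ^ (c / 2) * (2 * (δ * (n : ℝ) ^ (1 - c))) := by gcongr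
        _ = 12 * (δ * ((n : ℝ) ^ (c / 2) * (n : ℝ) ^ (1 - c))) := by ring
        _ ≤ (n : ℝ) ^ (c / 2) * (δ * ((n : ℝ) ^ (c / 2) * (n : ℝ) ^ (1 - c))) := by gcongr
        _ = δ * ((n : ℝ) ^ (c / 2) * ((n : ℝ) ^ (c / 2) * (n : ℝ) ^ (1 - c))) := by ring
        _ = δ * n := by rw [← h5]
    have h5 := h4.trans (Nat.le_ceil _)
    exact_mod_cast h5
  have htq : n < t ^ q := by
    have h4 : (n : ℝ) < (t : ℝ) ^ q := by
      calc (n : ℝ) = (n : ℝ) ^ (1 : ℝ) := (Real.rpow_one _).symm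
        _ < (n : ℝ) ^ (c / 4 * q) := Real.rpow_lt_rpow_of_exponent_lt hn1 (by linarith)
        _ = ((n : ℝ) ^ (c / 4)) ^ q := Real.rpow_mul_natCast hn0.le _ _
        _ ≤ (t : ℝ) ^ q := pow_le_pow_left₀ (by positivity) htge q
    exact_mod_cast h4
  refine hspread.false_of_large hG ht1 hq1 htm htq hX rfl ?_
  have hd1 : 1 ≤ d := hspread.d_pos
  have hMd : d * M ≤ n := by
    have h4 : (d : ℝ) * M ≤ n := by
      calc (d : ℝ) * M ≤ 2 * (δ * n) * M := by gcongr
        _ = n := by rw [hδ]; field_simp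
    exact_mod_cast h4
  calc 2 ^ q * ((q + 1) * (q + 1) * (2 * d * X ^ 2 ^ q)) +
        (q + 1) * (2 * d * X ^ 2 ^ q + 1 + 3 * d)
      ≤ 2 ^ q * ((q + 1) * (q + 1) * (2 * d * X ^ 2 ^ q)) +
        (q + 1) * (2 * d * X ^ 2 ^ q + d + 3 * d) := by gcongr
    _ = d * M := by rw [hM, hF]; ring
    _ ≤ n := hMd

/-- The conclusion of `exists_anticomplete_pair` inside a large set of vertices. -/
theorem exists_anticomplete_pair_of_subset {δ σ c : ℝ} {N : ℕ} (hσ : 0 < σ) (hσ1 : σ ≤ 1)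
    (hδ : 0 < δ) (hc : 0 < c) (hc1 : c < 1)
    (h : ∀ (V : Type u) [Fintype V] (G : SimpleGraph V),
      G.CliqueIndepBound → N ≤ Fintype.card V →
      (∀ v, ((G.nbrs {v} Finset.univ).card : ℝ) ≤ δ * Fintype.card V) →
      ∃ A B : Finset V, Disjoint A B ∧ (∀ a ∈ A, ∀ b ∈ B, ¬ G.Adj a b) ∧
        δ * Fintype.card V ≤ A.card ∧ δ * (Fintype.card V : ℝ) ^ (1 - c) ≤ B.card)
    [Fintype V] (hG : G.CliqueIndepBound) {Y : Finset V} (hY : σ * Fintype.card V ≤ Y.card)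
    (hN : N ≤ Y.card) (hdeg : ∀ v ∈ Y, ((G.nbrs {v} Y).card : ℝ) ≤ δ * Y.card) :
    ∃ A B : Finset V, Disjoint A B ∧ (∀ a ∈ A, ∀ b ∈ B, ¬ G.Adj a b) ∧
      δ * σ * Fintype.card V ≤ A.card ∧ δ * σ * (Fintype.card V : ℝ) ^ (1 - c) ≤ B.card := by
  classical
  set f : {x // x ∈ Y} ↪ V := Function.Embedding.subtype _ with hf
  have hcard : Fintype.card {x // x ∈ Y} = Y.card := Fintype.card_coe Y
  obtain ⟨A, B, hAB, hadj, hA, hB⟩ := h {x // x ∈ Y} (G.comap f) (hG.comap f) (by rwa [hcard]) (by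
    intro v
    rw [hcard]
    refine le_trans ?_ (hdeg v v.2)
    rw [← Finset.card_map f]
    norm_cast
    refine Finset.card_le_card ?_
    intro x hx
    obtain ⟨y, hy, rfl⟩ := Finset.mem_map.1 hx
    have := (mem_nbrs.1 hy).2
    simp only [Finset.mem_singleton, exists_eq_left, comap_adj] at this
    exact mem_nbrs.2 ⟨y.2, v, by simp, this⟩)
  rw [hcard] at hA hB
  refine ⟨A.map f, B.map f, (Finset.disjoint_map f).2 hAB, ?_, ?_, ?_⟩
  · intro a ha b hb
    obtain ⟨a', ha', rfl⟩ := Finset.mem_map.1 ha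
    obtain ⟨b', hb', rfl⟩ := Finset.mem_map.1 hb
    exact hadj a' ha' b' hb'
  · rw [Finset.card_map]
    refine le_trans ?_ hA
    rw [mul_assoc]
    gcongr
  · rw [Finset.card_map]
    refine le_trans ?_ hB
    rw [mul_assoc]
    gcongr
    -- Since σ ≤ 1, one factor σ pays for passing from |V|^(1-c) to |Y|^(1-c).
    have h1 : σ ≤ σ ^ (1 - c) := by
      conv_lhs => rw [← Real.rpow_one σ]
      exact Real.rpow_le_rpow_of_exponent_ge hσ hσ1 (by linarith)
    calc σ * (Fintype.card V : ℝ) ^ (1 - c) ≤ σ ^ (1 - c) * (Fintype.card V : ℝ) ^ (1 - c) := by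
          gcongr
      _ = (σ * Fintype.card V) ^ (1 - c) := (Real.mul_rpow hσ.le (by positivity)).symm
      _ ≤ (Y.card : ℝ) ^ (1 - c) := Real.rpow_le_rpow (by positivity) hY (by linarith)

end PurePairs

end SimpleGraph

theorem mainTheorem4 (c : ℝ) (hc : 0 < c) :
    ∃ ε : ℝ, 0 < ε ∧
      ∀ (V : Type u) [Fintype V] (G : SimpleGraph V),
        G.IsPerfect → 1 < Fintype.card V →
          ∃ A B : Finset V, G.IsPurePair A B ∧
            ε * (Fintype.card V : ℝ) ≤ (A.card : ℝ) ∧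
            ε * (Fintype.card V : ℝ) ^ (1 - c) ≤ (B.card : ℝ) := by
  -- Decreasing c only strengthens the conclusion, and c < 1 is needed for n^(1-c) to tend to
  -- infinity.
  have hb : 0 < min c (1 / 2) := lt_min hc (by norm_num)
  have hb1 : min c (1 / 2) < 1 := (min_le_right _ _).trans_lt (by norm_num)
  obtain ⟨δ, hδ, N₀, h₀⟩ := SimpleGraph.exists_anticomplete_pair.{u} hb hb1
  obtain ⟨σ, hσ, hσ1, N₁, h₁⟩ := SimpleGraph.exists_small_degree.{u} hδ
  set N : ℕ := max N₁ ⌈(N₀ : ℝ) / σ⌉₊ + 1 with hN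
  have hN0 : (0 : ℝ) < N := by exact_mod_cast Nat.succ_pos _
  refine ⟨min (δ * σ) (1 / N), by positivity, ?_⟩
  intro V _ G hG hV
  have hn1 : (1 : ℝ) ≤ Fintype.card V := by exact_mod_cast hV.le
  by_cases hVN : N ≤ Fintype.card V
  · have hmono : ∀ x y : ℝ, δ * σ * Fintype.card V ≤ x →
        δ * σ * (Fintype.card V : ℝ) ^ (1 - min c (1 / 2)) ≤ y →
        min (δ * σ) (1 / N) * (Fintype.card V : ℝ) ≤ x ∧
          min (δ * σ) (1 / N) * (Fintype.card V : ℝ) ^ (1 - c) ≤ y := by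
      intro x y hx hy
      refine ⟨le_trans ?_ hx, le_trans ?_ hy⟩
      · gcongr
        exact min_le_left _ _
      · have h2 : (Fintype.card V : ℝ) ^ (1 - c) ≤
            (Fintype.card V : ℝ) ^ (1 - min c (1 / 2)) :=
          Real.rpow_le_rpow_of_exponent_le hn1 (by linarith [min_le_left c (1 / 2)])
        gcongr
        exact min_le_left _ _
    have hQ := hG.cliqueIndepBound
    obtain ⟨Y, hY, hdeg⟩ := h₁ V G hQ (by omega)
    have hYN : N₀ ≤ Y.card := by
      have h2 : ⌈(N₀ : ℝ) / σ⌉₊ ≤ Fintype.card V := by omega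
      have h3 := Nat.ceil_le.1 h2
      rw [div_le_iff₀ hσ] at h3
      have h4 : (N₀ : ℝ) ≤ Y.card := by linarith
      exact_mod_cast h4
    rcases hdeg with hdeg | hdeg
    · obtain ⟨A, B, hAB, hadj, hA, hB⟩ := SimpleGraph.exists_anticomplete_pair_of_subset
        hσ hσ1 hδ hb hb1 h₀ hQ hY hYN hdeg
      exact ⟨A, B, ⟨hAB, Or.inr fun a ha b hb => hadj a ha b hb⟩, hmono _ _ hA hB⟩
    · obtain ⟨A, B, hAB, hadj, hA, hB⟩ := SimpleGraph.exists_anticomplete_pair_of_subset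
        hσ hσ1 hδ hb hb1 h₀ hQ.compl hY hYN hdeg
      refine ⟨A, B, ⟨hAB, Or.inl fun a ha b hb => ?_⟩, hmono _ _ hA hB⟩
      have hne : a ≠ b := fun e => Finset.disjoint_left.1 hAB ha (e ▸ hb)
      by_contra hnadj
      exact hadj a ha b hb ((SimpleGraph.compl_adj _ _ _).2 ⟨hne, hnadj⟩)
  -- For fewer than N vertices, ε ≤ 1/N makes both bounds at most 1, and two distinct singletons
  -- suffice.
  · obtain ⟨a, b, hab⟩ := Fintype.one_lt_card_iff.1 hV
    have h2 : min (δ * σ) (1 / N) * (Fintype.card V : ℝ) ≤ 1 := by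
      have h3 : (Fintype.card V : ℝ) ≤ N := by exact_mod_cast (not_le.1 hVN).le
      calc min (δ * σ) (1 / N) * (Fintype.card V : ℝ) ≤ 1 / N * N := by
            gcongr
            exact min_le_right _ _
        _ = 1 := by field_simp
    refine ⟨{a}, {b}, ⟨by simpa using hab, ?_⟩, by simpa using h2, ?_⟩
    · by_cases hadj : G.Adj a b
      · left
        intro x hx y hy
        simp only [Finset.coe_singleton, Set.mem_singleton_iff] at hx hy
        rwa [hx, hy]
      · right
        intro x hx y hy
        simp only [Finset.coe_singleton, Set.mem_singleton_iff] at hx hy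
        rwa [hx, hy]
    · have h3 : (Fintype.card V : ℝ) ^ (1 - c) ≤ Fintype.card V := by
        conv_rhs => rw [← Real.rpow_one (Fintype.card V : ℝ)]
        exact Real.rpow_le_rpow_of_exponent_le hn1 (by linarith)
      rw [Finset.card_singleton, Nat.cast_one]
      refine le_trans ?_ h2
      gcongr
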